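/- Let $d_1,d_2,d_3\in\mathbb C$ be distinct, let $\alpha,\beta,\gamma,\delta,\epsilon,q'\in\mathbb C$ with $\alpha+\beta-\gamma-\delta-\epsilon+1=0$, and consider the canonical natural general-form Heun equation $$u''+\left(\frac{\gamma}{s-d_1}+\frac{\delta}{s-d_2}+\frac{\epsilon}{s-d_3}\right)u'+\frac{\alpha\beta s-q'}{(s-d_1)(s-d_2)(s-d_3)}\,u=0 .$$ Suppose that it has four singular points (that is, each of $d_1,d_2,d_3,\infty$ is a singular point) and is nontrivial ($\alpha\beta\ne0$ or $q'\ne0$). A nonconstant rational function $R$ is said to reduce it to a hypergeometric equation if there are $a,b,c\in\mathbb C$ such that the substitution $z=R(s)$ (of the independent variable only) turns $$\frac{d^2y}{dz^2}+\left(\frac cz+\frac{a+b-c+1}{z-1}\right)\frac{dy}{dz}+\frac{ab}{z(z-1)}\,y=0$$ into the given equation; that is, the coefficients of $u'$ and $u$ above equal, respectively, $$\left(\frac cR+\frac{a+b-c+1}{R-1}\right)R'-\frac{R''}{R'}\qquad\text{and}\qquad \frac{ab\,R'^2}{R(R-1)} .$$ Consider the following seven subcases. Each gives a number $D$, a condition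 on numbers $\theta_0,\theta_1,\theta_D$, a number $p_0$, and a polynomial $R_1(t)$. * (1a) $D=2$; $\theta_0=\theta_D$; $p_0=1$; $R_1=t(2-t)$. * (1b) $D=4$; $1-\theta_1=2(1-\theta_D)$ and $\theta_0=\frac12$; $p_0=1$; $R_1=(t-1)^2(1-t/4)$. * (1c) $D=2$; $\theta_0=\theta_D$ and $1-\theta_1=2(1-\theta_0)$; $p_0=1$; $R_1=4[t(2-t)-\frac12]^2$. * (2a) $D=\frac12+i\frac{\sqrt3}2$; $\theta_0=\theta_1=\theta_D$; $p_0=\frac12+i\frac{\sqrt3}6$; $R_1=(1-t/p_0)^3$. * (2b) $D=\frac12+i\frac{5\sqrt2}4$; $\theta_0=\theta_1=\frac12$ and $\theta_D=\frac23$; $p_0=\frac12+i\frac{\sqrt2}4$; $R_1=(1-t/D)(1-t/p_0)^3$. * (2c) $D=\frac12+i\frac{11\sqrt{15}}{90}$; $\theta_0=\theta_1=\frac23$ and $\theta_D=\frac12$; $p_0=\frac12+i\frac{\sqrt{15}}{18}$; $R_1=-i\frac{2025\sqrt{15}}{64}\,t(t-1)(t-p_0)^3$. * (2d) $D=\frac12+i\frac{\sqrt3}2$;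 $\theta_0=\theta_1=\theta_D=\frac23$; $p_0=\frac12+i\frac{\sqrt3}6$; $R_1=4[(1-t/p_0)^3-\frac12]^2$. Say that the equation satisfies the conditions of a subcase via $A$ if the following hold. * (i) $\triangle d_1d_2d_3$ is similar to $\triangle01D$, in that the complex affine map $A(s)=ms+n$, $m\ne0$, maps $\{d_1,d_2,d_3\}$ onto $\{0,1,D\}$. * (ii) The condition on $\theta_0,\theta_1,\theta_D$ holds when $\theta_v$ denotes the one of the parameters $\gamma,\delta,\epsilon$ (belonging to $d_1,d_2,d_3$ respectively) that belongs to the point $A^{-1}(v)$. * (iii) $q'=\alpha\beta\,A^{-1}(p_0)$. Then: 1. The equation can be reduced to a hypergeometric equation by some rational substitution $z=R(s)$ if and only if $\alpha\beta\neq0$ and the equation satisfies the conditions of at least one subcase via some $A$. 2. A given rational function $R$ reduces the equation to a hypergeometric equation if and only if $\alpha\beta\ne0$, $R$ is a polynomial, and there are a subcase and an $A$ such that the equation satisfies the conditions of the subcase via $A$ and $R=R_1\circ A$ or $R=1-R_1\circ A$. 3. For each subcase for which (i) and (ii) hold via some $A$, the value of the accessory parameter required by (iii) is unique: it is the same for every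 $A$ for which (i) and (ii) hold. -/

import Mathlib

open Polynomial Filter Topology

noncomputable section

/-- The linear second-order differential equation `u'' + p u' + r u = 0` on the complex plane. -/
structure LinearODE2 where
  p : ℂ → ℂ
  r : ℂ → ℂ

namespace LinearODE2

/-- The equation obtained from `y'' + p(z) y' + r(z) y = 0` by the change `z = R(s)` of the
independent variable, divided by the leading coefficient: if `u = y ∘ R`, then `u' = (y' ∘ R) R'`
and `u'' = (y'' ∘ R) R' ^ 2 + (y' ∘ R) R''`, so that
`u'' + (p(R) R' - R'' / R') u' + r(R) R' ^ 2 u = 0`. -/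
def pullback (E : LinearODE2) (R : ℂ → ℂ) : LinearODE2 where
  p := fun s => E.p (R s) * deriv R s - deriv (deriv R) s / deriv R s
  r := fun s => E.r (R s) * deriv R s ^ 2

/-- `s₀` is an ordinary point if both coefficients extend analytically to `s₀`. -/
def IsOrdinaryAt (E : LinearODE2) (s₀ : ℂ) : Prop :=
  ∃ P Q : ℂ → ℂ, AnalyticAt ℂ P s₀ ∧ AnalyticAt ℂ Q s₀ ∧
    E.p =ᶠ[𝓝[≠] s₀] P ∧ E.r =ᶠ[𝓝[≠] s₀] Q

/-- `s₀` is a singular point. -/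
def IsSingularAt (E : LinearODE2) (s₀ : ℂ) : Prop := ¬ E.IsOrdinaryAt s₀

/-- The point at infinity is a singular point, seen in the coordinate `w = 1 / s`. -/
def IsSingularAtInfinity (E : LinearODE2) : Prop :=
  (E.pullback fun w => w⁻¹).IsSingularAt 0

/-- Two equations with rational coefficients are the same equation if their coefficients agree
outside a finite set, that is, as rational functions. -/
def Same (E F : LinearODE2) : Prop :=
  E.p =ᶠ[cofinite] F.p ∧ E.r =ᶠ[cofinite] F.r

end LinearODE2

/-- The Gauss hypergeometric equation with parameters `a, b; c`. -/
def hypergeometricODE (a b c : ℂ) : LinearODE2 where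
  p := fun z => c / z + (a + b - c + 1) / (z - 1)
  r := fun z => a * b / (z * (z - 1))

/-- The canonical natural general-form Heun equation, with finite singular points `d₁, d₂, d₃`,
exponent parameters `α, β, γ, δ, ε` and accessory parameter `q`. -/
def generalHeunODE (d₁ d₂ d₃ α β γ δ ε q : ℂ) : LinearODE2 where
  p := fun s => γ / (s - d₁) + δ / (s - d₂) + ε / (s - d₃)
  r := fun s => (α * β * s - q) / ((s - d₁) * (s - d₂) * (s - d₃))

/-- The equation `E` is reduced to the hypergeometric equation with parameters `a, b; c` by the
substitution `z = R(s)`, where `R` is a nonconstant rational function: pulling the hypergeometric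
equation back along `R` gives `E`. -/
def ReducesToHypergeometric (E : LinearODE2) (R : RatFunc ℂ) (a b c : ℂ) : Prop :=
  (∀ k : ℂ, R ≠ RatFunc.C k) ∧
    ((hypergeometricODE a b c).pullback fun s => R.eval (RingHom.id ℂ) s).Same E

/-- The seven types of reduction, named by the position of the three finite singular points and
the degree of the substitution. -/
inductive ReductionType where
  | harmonicQuadratic
  | collinearCubic
  | harmonicQuartic
  | equianharmonicCubic
  | isoscelesQuartic
  | isoscelesQuintic
  | equianharmonicSextic

namespace ReductionType

/-- The third vertex `D` of the model triangle with vertices `0, 1, D`. -/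
def D : ReductionType → ℂ
  | harmonicQuadratic => 2
  | collinearCubic => 4
  | harmonicQuartic => 2
  | equianharmonicCubic => 1 / 2 + Complex.I * (Real.sqrt 3 : ℂ) / 2
  | isoscelesQuartic => 1 / 2 + Complex.I * (5 * (Real.sqrt 2 : ℂ)) / 4
  | isoscelesQuintic => 1 / 2 + Complex.I * (11 * (Real.sqrt 15 : ℂ)) / 90
  | equianharmonicSextic => 1 / 2 + Complex.I * (Real.sqrt 3 : ℂ) / 2

/-- The normalized accessory parameter `q / (α β)` required when the singular points are
`0, 1, D`. -/
def p₀ : ReductionType → ℂ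
  | harmonicQuadratic => 1
  | collinearCubic => 1
  | harmonicQuartic => 1
  | equianharmonicCubic => 1 / 2 + Complex.I * (Real.sqrt 3 : ℂ) / 6
  | isoscelesQuartic => 1 / 2 + Complex.I * (Real.sqrt 2 : ℂ) / 4
  | isoscelesQuintic => 1 / 2 + Complex.I * (Real.sqrt 15 : ℂ) / 18
  | equianharmonicSextic => 1 / 2 + Complex.I * (Real.sqrt 3 : ℂ) / 6

/-- The condition on the exponent parameters `γ, δ, ε` belonging to the singular points
`0, 1, D`, in this order. -/
def ExponentCondition : ReductionType → ℂ → ℂ → ℂ → Prop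
  | harmonicQuadratic, γ, _, ε => γ = ε
  | collinearCubic, γ, δ, ε => 1 - δ = 2 * (1 - ε) ∧ γ = 1 / 2
  | harmonicQuartic, γ, δ, ε => γ = ε ∧ 1 - δ = 2 * (1 - γ)
  | equianharmonicCubic, γ, δ, ε => γ = δ ∧ δ = ε
  | isoscelesQuartic, γ, δ, ε => γ = 1 / 2 ∧ δ = 1 / 2 ∧ ε = 2 / 3
  | isoscelesQuintic, γ, δ, ε => γ = 2 / 3 ∧ δ = 2 / 3 ∧ ε = 1 / 2
  | equianharmonicSextic, γ, δ, ε => γ = 2 / 3 ∧ δ = 2 / 3 ∧ ε = 2 / 3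

/-- The polynomial substitution `z = R₁(t)` when the singular points are `0, 1, D`. -/
def R₁ : ReductionType → ℂ[X]
  | harmonicQuadratic => X * (2 - X)
  | collinearCubic => (X - 1) ^ 2 * (1 - C (1 / 4) * X)
  | harmonicQuartic => 4 * (X * (2 - X) - C (1 / 2)) ^ 2
  | equianharmonicCubic => (1 - C (equianharmonicCubic.p₀)⁻¹ * X) ^ 3
  | isoscelesQuartic =>
      (1 - C (isoscelesQuartic.D)⁻¹ * X) * (1 - C (isoscelesQuartic.p₀)⁻¹ * X) ^ 3
  | isoscelesQuintic =>
      C (-Complex.I * (2025 * (Real.sqrt 15 : ℂ)) / 64) *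
        (X * (X - 1) * (X - C isoscelesQuintic.p₀) ^ 3)
  | equianharmonicSextic =>
      4 * ((1 - C (equianharmonicSextic.p₀)⁻¹ * X) ^ 3 - C (1 / 2)) ^ 2

/-- A similarity of the (possibly degenerate) triangle with vertices `d 0, d 1, d 2` with the model
triangle with vertices `0, 1, D`: an affine map `s ↦ m s + n` of the complex plane that takes the
three points `d i`, in some order, to `0, 1, D`. The permutation `σ` records the order. -/
structure Similarity (k : ReductionType) (d : Fin 3 → ℂ) where
  σ : Equiv.Perm (Fin 3)
  m : ℂ
  n : ℂ
  m_ne_zero : m ≠ 0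
  map_zero : m * d (σ 0) + n = 0
  map_one : m * d (σ 1) + n = 1
  map_D : m * d (σ 2) + n = k.D

namespace Similarity

variable {k : ReductionType} {d : Fin 3 → ℂ}

/-- The preimage of a point under the affine map. -/
def preimage (A : k.Similarity d) (t : ℂ) : ℂ := (t - A.n) / A.m

/-- The exponent parameters `θ i` at the points `d i` satisfy the condition of the subcase, when
these points are identified with `0, 1, D` by the similarity. -/
def ExponentCondition (A : k.Similarity d) (θ : Fin 3 → ℂ) : Prop :=
  k.ExponentCondition (θ (A.σ 0)) (θ (A.σ 1)) (θ (A.σ 2))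

/-- The composition of the affine map with the polynomial substitution of the subcase. -/
def substitution (A : k.Similarity d) : ℂ[X] := k.R₁.comp (C A.m * X + C A.n)

end Similarity

end ReductionType

end

/-! Everything is read off from orders of vanishing. For `R = P/Q` in lowest terms, equality of the
coefficients of `u` is a polynomial identity in which `(P'Q - PQ')² ∏ (s - dᵢ)` is proportional to
`(αβ s - q') Q² P (P - Q)`. A pole of `R` would require a double zero of `∏ (s - dᵢ)`, so `R` is a
polynomial `P`; comparing degrees then gives `αβ ≠ 0`. With `p = q'/(αβ)` the identity becomes `κ
P'² ∏ (s - dᵢ) = (s - p) P (1 - P)`, and the coefficients of `u'` are compared through their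
residues, with exponent parameters `e₀, e₁` over `z = 0, 1`.

Locally (`rootMultiplicity_identity`, `residue`), a root of `P` is simple at `dᵢ ≠ p`, double at `p`
if `p` is some `dᵢ`, triple at `p` otherwise, and double anywhere else; the last two force `e₀ =
2/3` and `e₀ = 1/2` respectively. The roots of `1 - P` behave likewise with `e₁`. Since `dᵢ` is a
genuine singularity, `P(p)` is `0` or `1`, and the reflection `P ↦ 1 - P` allows `P(p) = 0`. Then
`2e₀ ≠ 1`, so all roots of `P` lie among `p` and the `dᵢ`. Up to permuting the `dᵢ`, three root
patterns remain when `p` is a `dᵢ` and four when it is not: these are the seven subcases. In each,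
cancelling common factors and comparing coefficients determines the `dᵢ` and `P` up to an affine map
(`isStandardReduction`).

Conversely, the identity is checked on each model triangle and carried over by affine maps. The
logarithmic derivative of the identity expresses `P''/P'`, so the coefficient of `u'` only needs a
partial fraction check (`of_logDeriv`); `a, b` then come from a quadratic equation. Finally, two
similarities differ by an affine symmetry of the model triangle, and `p₀` is a fixed point of every
such symmetry (`preimage_p₀_eq`). -/

/-! ### Polynomials off finite sets and residues of logarithmic derivatives. -/

theorem Polynomial.eventually_cofinite_eval_ne_zero {p : ℂ[X]} (hp : p ≠ 0) :
    ∀ᶠ s in cofinite, p.eval s ≠ 0 := by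
  rw [eventually_cofinite]
  refine (p.rootSet_finite ℂ).subset fun s hs => ?_
  rw [mem_rootSet]
  exact ⟨hp, by simpa using hs⟩

theorem Polynomial.eq_of_eventually_cofinite_eval_eq {p q : ℂ[X]}
    (h : ∀ᶠ s in cofinite, p.eval s = q.eval s) : p = q := by
  refine eq_of_infinite_eval_eq p q ?_
  have := (eventually_cofinite.mp h).infinite_compl
  simpa [Set.compl_ofPred] using this

theorem Polynomial.rootMultiplicity_neg (p : ℂ[X]) (x : ℂ) :
    (-p).rootMultiplicity x = p.rootMultiplicity x := by
  classical
  rw [← count_roots, ← count_roots, roots_neg]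

/-- The residue of a logarithmic derivative. -/
theorem Polynomial.tendsto_sub_mul_logDeriv {p : ℂ[X]} (hp : p ≠ 0) (x : ℂ) :
    Tendsto (fun s => (s - x) * (p.derivative.eval s / p.eval s)) (𝓝[≠] x)
      (𝓝 (p.rootMultiplicity x : ℂ)) := by
  obtain ⟨u, hu, hdvd⟩ := exists_eq_pow_rootMultiplicity_mul_and_not_dvd p hp x
  set m := p.rootMultiplicity x
  have hux : u.eval x ≠ 0 := fun h => hdvd (dvd_iff_isRoot.mpr h)
  have hlim : Tendsto (fun s => (m : ℂ) + (s - x) * (u.derivative.eval s / u.eval s)) (𝓝[≠] x)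
      (𝓝 (m : ℂ)) := by
    have hc : ContinuousAt (fun s => (m : ℂ) + (s - x) * (u.derivative.eval s / u.eval s)) x := by
      refine continuousAt_const.add ((continuousAt_id.sub continuousAt_const).mul ?_)
      exact u.derivative.continuous.continuousAt.div u.continuous.continuousAt hux
    have := hc.tendsto.mono_left (nhdsWithin_le_nhds (s := {x}ᶜ))
    simpa using this
  refine hlim.congr' ?_
  have hev : ∀ᶠ s in 𝓝[≠] x, u.eval s ≠ 0 :=
    nhdsWithin_le_nhds (u.continuous.continuousAt.eventually_ne hux)
  filter_upwards [hev, self_mem_nhdsWithin] with s hs hsx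
  have hsx' : s - x ≠ 0 := sub_ne_zero.mpr hsx
  rw [hu]
  simp only [derivative_mul, derivative_X_sub_C_pow, eval_add, eval_mul, eval_pow, eval_sub, eval_X,
    eval_C]
  rcases Nat.eq_zero_or_pos m with h0 | h0
  · simp [h0]
  · obtain ⟨k, hk⟩ : ∃ k, m = k + 1 := ⟨m - 1, by omega⟩
    rw [hk]
    simp only [Nat.add_sub_cancel, Nat.cast_add, Nat.cast_one]
    field_simp
    ring

theorem Complex.tendsto_sub_mul_div_sub (θ d x : ℂ) :
    Tendsto (fun s => (s - x) * (θ / (s - d))) (𝓝[≠] x) (𝓝 (if d = x then θ else 0)) := by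
  split_ifs with h
  · subst h
    refine tendsto_const_nhds.congr' ?_
    filter_upwards [self_mem_nhdsWithin] with s hs
    have : s - d ≠ 0 := sub_ne_zero.mpr hs
    field_simp
  · have hc : ContinuousAt (fun s : ℂ => (s - x) * (θ / (s - d))) x := by
      refine (continuousAt_id.sub continuousAt_const).mul (continuousAt_const.div
        (continuousAt_id.sub continuousAt_const) (sub_ne_zero.mpr (Ne.symm h)))
    simpa using hc.tendsto.mono_left (nhdsWithin_le_nhds (s := {x}ᶜ))

/-! ### From a rational substitution to a polynomial identity. -/

/-- The polynomial substitution `P` pulls back the hypergeometric equation with exponent parameters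
`e₀`, `e₁` at `0`, `1` to the equation with singular points `d i`, exponent parameters `θ i` and
normalized accessory parameter `p`: equality of the coefficients of `u` as polynomials, and of those
of `u'` through their residues. -/
structure IsPolynomialReduction (d θ : Fin 3 → ℂ) (p e₀ e₁ : ℂ) (P : ℂ[X]) : Prop where
  derivative_ne_zero : derivative P ≠ 0
  injective : Function.Injective d
  exists_identity : ∃ κ : ℂ, κ ≠ 0 ∧
    C κ * derivative P ^ 2 * ∏ i, (X - C (d i)) = (X - C p) * P * (1 - P)
  residue : ∀ x, e₀ * P.rootMultiplicity x + e₁ * (1 - P).rootMultiplicity x -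
    (derivative P).rootMultiplicity x = ∑ i, if d i = x then θ i else 0
  exponent_ne_zero : ∀ i, p = d i → θ i ≠ 0

theorem prod_fin_three_X_sub_C (d₁ d₂ d₃ : ℂ) :
    ∏ i, (X - C ((![d₁, d₂, d₃] : Fin 3 → ℂ) i)) = (X - C d₁) * (X - C d₂) * (X - C d₃) := by
  simp [Fin.prod_univ_three]

theorem deriv_eval_polynomial (P : ℂ[X]) :
    deriv (fun s => P.eval s) = fun s => P.derivative.eval s :=
  funext fun _ => P.deriv

theorem Same.polynomial_identity {d₁ d₂ d₃ α β γ δ ε q κ : ℂ} {P Q : ℂ[X]} (hQ : Q ≠ 0) (hP : P ≠ 0)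
    (hPQ : P - Q ≠ 0)
    (h : (fun s => κ / (P.eval s / Q.eval s * (P.eval s / Q.eval s - 1)) *
      deriv (fun s => P.eval s / Q.eval s) s ^ 2) =ᶠ[cofinite]
        (generalHeunODE d₁ d₂ d₃ α β γ δ ε q).r) :
    C κ * (derivative P * Q - P * derivative Q) ^ 2 *
      ((X - C d₁) * (X - C d₂) * (X - C d₃)) =
        (C (α * β) * X - C q) * Q ^ 2 * (P * (P - Q)) := by
  refine eq_of_eventually_cofinite_eval_eq ?_
  filter_upwards [h, eventually_cofinite_eval_ne_zero hQ, eventually_cofinite_eval_ne_zero hP,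
    eventually_cofinite_eval_ne_zero hPQ, eventually_cofinite_eval_ne_zero (X_sub_C_ne_zero d₁),
    eventually_cofinite_eval_ne_zero (X_sub_C_ne_zero d₂),
    eventually_cofinite_eval_ne_zero (X_sub_C_ne_zero d₃)] with s hs hQ hP hPQ h₁ h₂ h₃
  have hd : deriv (fun s => P.eval s / Q.eval s) s =
      (P.derivative.eval s * Q.eval s - P.eval s * Q.derivative.eval s) / Q.eval s ^ 2 :=
    ((P.hasDerivAt s).div (Q.hasDerivAt s) hQ).deriv
  simp only [eval_sub, eval_X, eval_C] at hPQ h₁ h₂ h₃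
  have h1 : P.eval s / Q.eval s - 1 = (P.eval s - Q.eval s) / Q.eval s := by field_simp
  simp only [hd, generalHeunODE, h1] at hs
  simp only [eval_sub, eval_X, eval_C, eval_mul, eval_pow]
  field_simp at hs
  linear_combination hs

/-- At a root of `Q` of order `k + 1`, the factor `P'Q - PQ'` vanishes to order exactly `k`. As the
`d i` are distinct, the left side has order at most `2k + 1`, the right side at least `2k + 2`. -/
theorem isUnit_denominator_of_identity {d : Fin 3 → ℂ} (hd : Function.Injective d) {κ : ℂ}
    (hκ : κ ≠ 0) {P Q N : ℂ[X]} (hPQ : IsCoprime P Q) (hQ : Q ≠ 0)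
    (h : C κ * (derivative P * Q - P * derivative Q) ^ 2 * ∏ i, (X - C (d i)) =
        N * Q ^ 2 * (P * (P - Q))) : IsUnit Q := by
  by_contra hunit
  obtain ⟨x, hx⟩ := IsAlgClosed.exists_root Q (fun h0 => hunit (isUnit_iff_degree_eq_zero.mpr h0))
  have hPx : P.eval x ≠ 0 := by
    obtain ⟨a, b, hab⟩ := hPQ
    intro h0
    have := congrArg (eval x) hab
    simp [h0, hx.eq_zero] at this
  obtain ⟨u, hu, hdvd⟩ := exists_eq_pow_rootMultiplicity_mul_and_not_dvd Q hQ x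
  have hux : u.eval x ≠ 0 := fun h => hdvd (dvd_iff_isRoot.mpr h)
  obtain ⟨k, hk⟩ : ∃ k, Q.rootMultiplicity x = k + 1 :=
    ⟨Q.rootMultiplicity x - 1, by have := (rootMultiplicity_pos hQ).mpr hx; omega⟩
  rw [hk] at hu
  -- `W` is `P'Q - PQ'` divided by `(X - x)^k`; its value `-(k + 1) P(x) u(x)` at `x` is nonzero.
  set W := derivative P * (X - C x) * u - P * (C ((k : ℂ) + 1) * u + (X - C x) * derivative u)
    with hW
  have hWx : W.eval x ≠ 0 := by
    have : (k : ℂ) + 1 ≠ 0 := Nat.cast_add_one_ne_zero k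
    simp [hW, hPx, hux, this]
  have hWeq : derivative P * Q - P * derivative Q = (X - C x) ^ k * W := by
    rw [hu, hW]
    simp only [derivative_mul, derivative_X_sub_C_pow, Nat.add_sub_cancel, Nat.cast_add,
      Nat.cast_one]
    ring
  have hcancel : C κ * W ^ 2 * ∏ i, (X - C (d i)) =
      (X - C x) ^ 2 * (N * u ^ 2 * (P * (P - Q))) := by
    have hne : ((X - C x) ^ k) ^ 2 ≠ 0 := pow_ne_zero _ (pow_ne_zero _ (X_sub_C_ne_zero x))
    refine mul_left_cancel₀ hne ?_
    have h2 : N * Q ^ 2 * (P * (P - Q)) =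
      N * ((X - C x) ^ (k + 1) * u) ^ 2 * (P * (P - Q)) := by rw [← hu]
    rw [hWeq, h2] at h
    linear_combination h
  -- The right side has a double zero at `x`. Its value makes `x` one of the `d i`; its derivative
  -- then contradicts the simplicity of that zero on the left.
  have h0 := congrArg (eval x) hcancel
  have h1 := congrArg (fun f => eval x (derivative f)) hcancel
  simp only [Fin.prod_univ_three] at h0 h1
  simp [hWx, hκ] at h0
  simp [derivative_pow] at h1
  have h01 := hd.ne (show (0 : Fin 3) ≠ 1 by decide)
  have h02 := hd.ne (show (0 : Fin 3) ≠ 2 by decide)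
  have h12 := hd.ne (show (1 : Fin 3) ≠ 2 by decide)
  rcases h0 with (h0 | h0) | h0 <;> rw [sub_eq_zero] at h0 <;> rw [h0] at h1 hWx <;>
    simp [hκ, hWx, sub_eq_zero, h01, h02, h12, h01.symm, h02.symm, h12.symm] at h1

/-- For `n = deg P` the left side has degree `2(n - 1) + 3 = 2n + 1`, while `A = 0` would leave
degree `2n` on the right. -/
theorem leadingCoeff_ne_zero_of_identity {d : Fin 3 → ℂ} {κ A q : ℂ} (hκ : κ ≠ 0) {P : ℂ[X]}
    (hP : derivative P ≠ 0)
    (h : C κ * derivative P ^ 2 * ∏ i, (X - C (d i)) = (C A * X - C q) * (P * (P - 1))) :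
    A ≠ 0 := by
  rintro rfl
  have hP0 : P.natDegree ≠ 0 := fun h0 => hP (derivative_eq_zero.mpr h0)
  have hPne : P ≠ 0 := by rintro rfl; simp at hP0
  have hdeg1 : (P - 1).natDegree = P.natDegree := by
    rw [← C_1]; exact natDegree_sub_C
  have hP1ne : P - 1 ≠ 0 := by intro h0; rw [h0] at hdeg1; simp at hdeg1; omega
  have hprod : (∏ i, (X - C (d i))) ≠ 0 := Finset.prod_ne_zero_iff.mpr fun i _ => X_sub_C_ne_zero _
  have hL : C κ * derivative P ^ 2 * ∏ i, (X - C (d i)) ≠ 0 := by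
    simp [hκ, hP, hprod]
  have hdegL : (C κ * derivative P ^ 2 * ∏ i, (X - C (d i))).natDegree =
      2 * (P.natDegree - 1) + 3 := by
    rw [natDegree_mul (by simp [hκ, hP]) hprod, natDegree_C_mul hκ, natDegree_pow,
      natDegree_derivative, natDegree_prod _ _ fun i _ => X_sub_C_ne_zero _]
    simp
  rw [h] at hL hdegL
  simp only [map_zero, zero_mul, zero_sub, ← C_neg] at hL hdegL
  have hq : -q ≠ 0 := by rintro h0; simp [h0] at hL
  rw [natDegree_C_mul hq, natDegree_mul hPne hP1ne, hdeg1] at hdegL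
  omega

/-- The factor `s - d₁` cancels from the coefficient of `u`. In contrapositive form this turns the
singularity hypotheses into `exponent_ne_zero`. -/
theorem generalHeunODE_isOrdinaryAt {d₁ d₂ d₃ α β δ ε q : ℂ} (h₁₂ : d₁ ≠ d₂) (h₁₃ : d₁ ≠ d₃)
    (hq : q = α * β * d₁) : (generalHeunODE d₁ d₂ d₃ α β 0 δ ε q).IsOrdinaryAt d₁ := by
  have h2 : AnalyticAt ℂ (fun s => s - d₂) d₁ := analyticAt_id.sub analyticAt_const
  have h3 : AnalyticAt ℂ (fun s => s - d₃) d₁ := analyticAt_id.sub analyticAt_const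
  have h2' : d₁ - d₂ ≠ 0 := sub_ne_zero.mpr h₁₂
  have h3' : d₁ - d₃ ≠ 0 := sub_ne_zero.mpr h₁₃
  refine ⟨fun s => δ / (s - d₂) + ε / (s - d₃), fun s => α * β / ((s - d₂) * (s - d₃)),
    (analyticAt_const.div h2 h2').add (analyticAt_const.div h3 h3'),
    analyticAt_const.div (h2.mul h3) (mul_ne_zero h2' h3'), ?_, ?_⟩
  · exact .of_forall fun s => by simp [generalHeunODE]
  · filter_upwards [self_mem_nhdsWithin] with s hs
    have hs' : s - d₁ ≠ 0 := sub_ne_zero.mpr hs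
    simp only [generalHeunODE, hq]
    rw [show α * β * s - α * β * d₁ = (s - d₁) * (α * β) by ring, mul_assoc (s - d₁),
      mul_div_mul_left _ _ hs']

theorem generalHeunODE_swap₁₂ (d₁ d₂ d₃ α β γ δ ε q : ℂ) :
    generalHeunODE d₁ d₂ d₃ α β γ δ ε q = generalHeunODE d₂ d₁ d₃ α β δ γ ε q := by
  simp only [generalHeunODE, LinearODE2.mk.injEq]
  constructor <;> funext s
  · ring
  · rw [mul_comm (s - d₁)]

theorem generalHeunODE_swap₁₃ (d₁ d₂ d₃ α β γ δ ε q : ℂ) :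
    generalHeunODE d₁ d₂ d₃ α β γ δ ε q = generalHeunODE d₃ d₂ d₁ α β ε δ γ q := by
  simp only [generalHeunODE, LinearODE2.mk.injEq]
  constructor <;> funext s
  · ring
  · rw [show (s - d₁) * (s - d₂) * (s - d₃) = (s - d₃) * (s - d₂) * (s - d₁) by ring]

theorem injective_vec_three {d₁ d₂ d₃ : ℂ} (h₁₂ : d₁ ≠ d₂) (h₁₃ : d₁ ≠ d₃) (h₂₃ : d₂ ≠ d₃) :
    Function.Injective ![d₁, d₂, d₃] := by
  intro i j hij
  fin_cases i <;> fin_cases j <;>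
    simp_all [h₁₂.symm, h₁₃.symm, h₂₃.symm]

/-- Multiply by `s - x` and let `s → x`: the pulled back coefficient of `u'` is a combination of
logarithmic derivatives of `P`, `1 - P` and `P'`. -/
theorem residue_of_same {d₁ d₂ d₃ α β γ δ ε q e₀ e₁ : ℂ} {P : ℂ[X]} (hP' : derivative P ≠ 0)
    (h : (fun s => (e₀ / P.eval s + e₁ / (P.eval s - 1)) * deriv (fun s => P.eval s) s -
      deriv (deriv fun s => P.eval s) s / deriv (fun s => P.eval s) s) =ᶠ[cofinite]
        (generalHeunODE d₁ d₂ d₃ α β γ δ ε q).p) (x : ℂ) :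
    e₀ * P.rootMultiplicity x + e₁ * (1 - P).rootMultiplicity x -
      (derivative P).rootMultiplicity x =
        ∑ i, if (![d₁, d₂, d₃] : Fin 3 → ℂ) i = x then (![γ, δ, ε] : Fin 3 → ℂ) i else 0 := by
  have hP : P ≠ 0 := by rintro rfl; simp at hP'
  have hP1 : 1 - P ≠ 0 := by
    intro h0; rw [← sub_eq_zero.mp h0] at hP'; simp at hP'
  have hL := (((tendsto_sub_mul_logDeriv hP x).const_mul e₀).add
    ((tendsto_sub_mul_logDeriv hP1 x).const_mul e₁)).sub (tendsto_sub_mul_logDeriv hP' x)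
  have hR := ((Complex.tendsto_sub_mul_div_sub γ d₁ x).add
    (Complex.tendsto_sub_mul_div_sub δ d₂ x)).add (Complex.tendsto_sub_mul_div_sub ε d₃ x)
  rw [Fin.sum_univ_three]
  refine tendsto_nhds_unique hL (hR.congr' ?_)
  filter_upwards [h.filter_mono (nhdsNE_le_cofinite (a := x))] with s hs
  simp only [generalHeunODE, deriv_eval_polynomial] at hs
  rw [← mul_add, ← mul_add, ← hs]
  simp only [derivative_sub, derivative_one, zero_sub, eval_neg, eval_sub, eval_one]
  rw [show P.eval s - 1 = -(1 - P.eval s) by ring, div_neg, neg_div]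
  ring

theorem ReducesToHypergeometric.isPolynomialReduction {d₁ d₂ d₃ α β γ δ ε q a b c : ℂ}
    {R : RatFunc ℂ} (h₁₂ : d₁ ≠ d₂) (h₁₃ : d₁ ≠ d₃) (h₂₃ : d₂ ≠ d₃)
    (hsing₁ : (generalHeunODE d₁ d₂ d₃ α β γ δ ε q).IsSingularAt d₁)
    (hsing₂ : (generalHeunODE d₁ d₂ d₃ α β γ δ ε q).IsSingularAt d₂)
    (hsing₃ : (generalHeunODE d₁ d₂ d₃ α β γ δ ε q).IsSingularAt d₃)
    (hnontrivial : α * β ≠ 0 ∨ q ≠ 0)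
    (h : ReducesToHypergeometric (generalHeunODE d₁ d₂ d₃ α β γ δ ε q) R a b c) :
    α * β ≠ 0 ∧ ∃ P : ℂ[X], R = algebraMap ℂ[X] (RatFunc ℂ) P ∧
      IsPolynomialReduction ![d₁, d₂, d₃] ![γ, δ, ε] (q / (α * β)) c (a + b - c + 1) P := by
  obtain ⟨hR, hp, hr⟩ := h
  have hd := injective_vec_three h₁₂ h₁₃ h₂₃
  have hQ0 := R.denom_ne_zero
  have hP0 : R.num ≠ 0 := by
    intro h0; exact hR 0 (by rw [map_zero]; exact RatFunc.num_eq_zero_iff.mp h0)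
  have hPQ0 : R.num - R.denom ≠ 0 := by
    intro h0
    refine hR 1 ?_
    rw [← R.num_div_denom, sub_eq_zero.mp h0, map_one]
    exact div_self (RatFunc.algebraMap_ne_zero hQ0)
  simp only [LinearODE2.pullback, hypergeometricODE, RatFunc.eval, eval₂_id] at hp hr
  have hid := Same.polynomial_identity hQ0 hP0 hPQ0 hr
  have hN : C (α * β) * X - C q ≠ 0 := by
    intro h0
    have e0 := congrArg (eval 0) h0
    have e1 := congrArg (eval 1) h0
    simp at e0 e1
    simp [e0] at e1 hnontrivial
    tauto
  have hκ : a * b ≠ 0 := by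
    intro h0
    rw [h0, C_0, zero_mul, zero_mul] at hid
    exact mul_ne_zero (mul_ne_zero hN (pow_ne_zero 2 hQ0)) (mul_ne_zero hP0 hPQ0) hid.symm
  rw [← prod_fin_three_X_sub_C] at hid
  have hunit := isUnit_denominator_of_identity hd hκ R.isCoprime_num_denom hQ0 hid
  have hden : R.denom = 1 := R.monic_denom.eq_one_of_isUnit hunit
  have hRP : R = algebraMap ℂ[X] (RatFunc ℂ) R.num := by
    conv_lhs => rw [← R.num_div_denom, hden, map_one, div_one]
  set P := R.num
  rw [hden] at hid
  simp only [hden, eval_one, div_one] at hp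
  simp only [mul_one, derivative_one, mul_zero, sub_zero, one_pow] at hid
  have hP' : derivative P ≠ 0 := by
    intro h0
    obtain ⟨k, hk⟩ := natDegree_eq_zero.mp (derivative_eq_zero.mp h0)
    exact hR k (by rw [hRP, ← hk, RatFunc.algebraMap_C])
  have hαβ := leadingCoeff_ne_zero_of_identity hκ hP' hid
  -- Dividing by `αβ` makes the linear factor monic; the sign turns `P (P - 1)` into `P (1 - P)`.
  refine ⟨hαβ, P, hRP, hP', hd, ⟨-(a * b) / (α * β), by simpa using And.intro hκ hαβ, ?_⟩,
    residue_of_same hP' hp, ?_⟩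
  · have hC : C (α * β) ≠ 0 := C_ne_zero.mpr hαβ
    refine mul_left_cancel₀ hC ?_
    have h1 : C (α * β) * C (-(a * b) / (α * β)) = -C (a * b) := by
      rw [← C_mul, ← C_neg, mul_div_cancel₀ _ hαβ]
    have h2 : C (α * β) * C (q / (α * β)) = C q := by
      rw [← C_mul, mul_div_cancel₀ _ hαβ]
    linear_combination -hid +
      (derivative P ^ 2 * ∏ i, (X - C ((![d₁, d₂, d₃] : Fin 3 → ℂ) i))) * h1 + (P * (1 - P)) * h2
  · intro i hi h0
    have hq : ∀ x, q / (α * β) = x → q = α * β * x := by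
      rintro x rfl; rw [mul_div_cancel₀ _ hαβ]
    fin_cases i
    · refine hsing₁ ?_
      rw [show γ = 0 from h0]
      exact generalHeunODE_isOrdinaryAt h₁₂ h₁₃ (hq _ hi)
    · refine hsing₂ ?_
      rw [show δ = 0 from h0, generalHeunODE_swap₁₂]
      exact generalHeunODE_isOrdinaryAt h₁₂.symm h₂₃ (hq _ hi)
    · refine hsing₃ ?_
      rw [show ε = 0 from h0, generalHeunODE_swap₁₃]
      exact generalHeunODE_isOrdinaryAt h₂₃.symm h₁₃.symm (hq _ hi)

/-! ### Factorization over prescribed roots; symmetries of the standard reductions. -/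

theorem Polynomial.eq_C_mul_prod_of_roots {ι : Type*} [Fintype ι] {a : ι → ℂ}
    (ha : Function.Injective a) {P : ℂ[X]} (hroots : ∀ x, P.rootMultiplicity x ≠ 0 → ∃ i, x = a i) :
    P = C P.leadingCoeff * ∏ i, (X - C (a i)) ^ P.rootMultiplicity (a i) := by
  classical
  rcases eq_or_ne P 0 with rfl | hP
  · simp
  conv_lhs => rw [(IsAlgClosed.splits P).eq_prod_roots, prod_multiset_root_eq_finset_root]
  congr 1
  rw [← Finset.prod_image (s := Finset.univ) (g := a)
    (f := fun x => (X - C x) ^ P.rootMultiplicity x) ha.injOn]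
  refine Finset.prod_subset (fun x hx => ?_) fun x _ hx => ?_
  · have hx' : P.rootMultiplicity x ≠ 0 := by
      rw [← count_roots, Multiset.count_ne_zero]; simpa using hx
    obtain ⟨i, rfl⟩ := hroots x hx'
    exact Finset.mem_image_of_mem _ (Finset.mem_univ i)
  · have : P.rootMultiplicity x = 0 := by
      rw [← count_roots, Multiset.count_eq_zero]; simpa using hx
    rw [this, pow_zero]

/-- The substitution `P` is one of the standard ones. -/
def IsStandardReduction (d θ : Fin 3 → ℂ) (p : ℂ) (P : ℂ[X]) : Prop :=
  ∃ (k : ReductionType) (A : k.Similarity d), A.ExponentCondition θ ∧ p = A.preimage k.p₀ ∧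
    (P = A.substitution ∨ P = 1 - A.substitution)

theorem IsStandardReduction.one_sub {d θ : Fin 3 → ℂ} {p : ℂ} {P : ℂ[X]}
    (h : IsStandardReduction d θ p (1 - P)) : IsStandardReduction d θ p P := by
  obtain ⟨k, A, h1, h2, h3⟩ := h
  refine ⟨k, A, h1, h2, ?_⟩
  rcases h3 with h3 | h3
  · right; rw [← h3]; ring
  · left; linear_combination -h3

theorem IsStandardReduction.of_comp {d θ : Fin 3 → ℂ} {p : ℂ} {P : ℂ[X]} (τ : Equiv.Perm (Fin 3))
    (h : IsStandardReduction (d ∘ τ) (θ ∘ τ) p P) : IsStandardReduction d θ p P := by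
  obtain ⟨k, A, h1, h2, h3⟩ := h
  exact ⟨k, ⟨A.σ.trans τ, A.m, A.n, A.m_ne_zero, A.map_zero, A.map_one, A.map_D⟩, h1, h2, h3⟩

/-- Here the vertices already come in the order `0, 1, D`; other orders are reached through
`of_comp`. -/
theorem IsStandardReduction.of_affine {d θ : Fin 3 → ℂ} {p : ℂ} {P : ℂ[X]} (k : ReductionType)
    (m n : ℂ) (h₀ : m * d 0 + n = 0) (h₁ : m * d 1 + n = 1) (hD : m * d 2 + n = k.D)
    (hθ : k.ExponentCondition (θ 0) (θ 1) (θ 2)) (hp : m * p + n = k.p₀)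
    (hP : (∀ s, P.eval s = k.R₁.eval (m * s + n)) ∨
      (∀ s, P.eval s = 1 - k.R₁.eval (m * s + n))) : IsStandardReduction d θ p P := by
  have hm : m ≠ 0 := by
    rintro rfl
    rw [zero_mul] at h₀ h₁
    exact zero_ne_one (h₀.symm.trans h₁)
  refine ⟨k, ⟨Equiv.refl _, m, n, hm, h₀, h₁, hD⟩, hθ, ?_, ?_⟩
  · rw [ReductionType.Similarity.preimage, ← hp]
    field_simp
    ring
  · refine hP.imp (fun h => ?_) (fun h => ?_) <;> refine funext fun s => ?_ <;>
      simp [h, ReductionType.Similarity.substitution]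

/-! ### Local multiplicities of `P` and `1 - P`. -/

namespace IsPolynomialReduction

variable {d θ : Fin 3 → ℂ} {p e₀ e₁ : ℂ} {P : ℂ[X]}

theorem ne_zero (h : IsPolynomialReduction d θ p e₀ e₁ P) : P ≠ 0 := by
  rintro rfl; simpa using h.derivative_ne_zero

theorem one_sub_ne_zero (h : IsPolynomialReduction d θ p e₀ e₁ P) : 1 - P ≠ 0 := by
  intro h0
  have := h.derivative_ne_zero
  rw [← sub_eq_zero.mp h0] at this
  simp at this

/-- The reflection `z ↦ 1 - z` exchanges the two finite singular points of the hypergeometric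
equation, so facts about roots of `P` transfer to roots of `1 - P`. -/
theorem swap (h : IsPolynomialReduction d θ p e₀ e₁ P) :
    IsPolynomialReduction d θ p e₁ e₀ (1 - P) := by
  obtain ⟨κ, hκ, hid⟩ := h.exists_identity
  refine ⟨by simpa using h.derivative_ne_zero, h.injective, ⟨κ, hκ, ?_⟩, fun x => ?_,
    h.exponent_ne_zero⟩
  · simp only [derivative_sub, derivative_one]
    linear_combination hid
  · rw [← h.residue x, sub_sub_cancel, derivative_sub, derivative_one, zero_sub,
      rootMultiplicity_neg]
    ring

theorem comp (h : IsPolynomialReduction d θ p e₀ e₁ P) (τ : Equiv.Perm (Fin 3)) :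
    IsPolynomialReduction (d ∘ τ) (θ ∘ τ) p e₀ e₁ P := by
  refine ⟨h.derivative_ne_zero, h.injective.comp τ.injective, ?_, fun x => ?_,
    fun i => h.exponent_ne_zero (τ i)⟩
  · have := Equiv.prod_comp τ fun i => X - C (d i)
    simpa only [Function.comp_apply, this] using h.exists_identity
  · rw [h.residue x]
    exact (Equiv.sum_comp τ fun i => if d i = x then θ i else 0).symm

/-- Compare the orders of vanishing at `x` of both sides of `exists_identity`. Since a root of order
`μ` of `P` or `1 - P` has order `μ - 1` in `P'`, this equation determines `μ`. -/
theorem rootMultiplicity_identity (h : IsPolynomialReduction d θ p e₀ e₁ P) (x : ℂ) :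
    2 * (derivative P).rootMultiplicity x + ∑ i, (if d i = x then 1 else 0) =
      (if p = x then 1 else 0) + P.rootMultiplicity x + (1 - P).rootMultiplicity x := by
  classical
  obtain ⟨κ, hκ, hid⟩ := h.exists_identity
  have := congrArg (fun f => f.roots.count x) hid
  have hp := X_sub_C_ne_zero p
  have hd := fun i => X_sub_C_ne_zero (d i)
  simp only [Fin.prod_univ_three] at this
  rw [roots_mul, roots_mul, roots_C, zero_add, roots_pow, roots_mul, roots_mul, roots_mul,
    roots_mul] at this
  · simp only [Multiset.count_add, Multiset.count_nsmul, roots_X_sub_C, Multiset.count_singleton,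
      count_roots] at this
    simp only [Fin.sum_univ_three, eq_comm (b := x)]
    exact this
  all_goals simp [hp, hd, h.ne_zero, h.one_sub_ne_zero, hκ, h.derivative_ne_zero]

theorem rootMultiplicity_derivative_of_root (h : IsPolynomialReduction d θ p e₀ e₁ P) {x : ℂ}
    (hx : P.rootMultiplicity x ≠ 0) :
    (derivative P).rootMultiplicity x + 1 = P.rootMultiplicity x ∧
      (1 - P).rootMultiplicity x = 0 := by
  have hroot : P.IsRoot x := (rootMultiplicity_pos h.ne_zero).mp (Nat.pos_of_ne_zero hx)
  refine ⟨?_, ?_⟩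
  · rw [derivative_rootMultiplicity_of_root hroot]; omega
  · refine rootMultiplicity_eq_zero ?_
    simp [hroot.eq_zero]

theorem rootMultiplicity_derivative_of_one_sub_root (h : IsPolynomialReduction d θ p e₀ e₁ P)
    {x : ℂ} (hx : (1 - P).rootMultiplicity x ≠ 0) :
    (derivative P).rootMultiplicity x + 1 = (1 - P).rootMultiplicity x := by
  have := (h.swap.rootMultiplicity_derivative_of_root hx).1
  simpa [rootMultiplicity_neg] using this

theorem sum_ite_eq (h : IsPolynomialReduction d θ p e₀ e₁ P) {M : Type*} [AddCommMonoid M]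
    (f : Fin 3 → M) (j : Fin 3) : (∑ i, if d i = d j then f i else 0) = f j := by
  simp [h.injective.eq_iff]

/-- At a point that is neither one of the `d i` nor `p`, the root is at most double. -/
theorem two_mul_eq_one_of_root (h : IsPolynomialReduction d θ p e₀ e₁ P) {x : ℂ}
    (hx : ∀ i, x ≠ d i) (hxp : x ≠ p) (hroot : P.rootMultiplicity x ≠ 0) : 2 * e₀ = 1 := by
  have h1 := h.rootMultiplicity_identity x
  have h2 := h.residue x
  obtain ⟨h3, h4⟩ := h.rootMultiplicity_derivative_of_root hroot
  simp only [(hx _).symm, hxp.symm, if_false, Finset.sum_const_zero] at h1 h2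
  -- `2(μ - 1) = μ`; the residue `2e₀ - 1` must vanish as `x` is not one of the `d i`.
  have h5 : P.rootMultiplicity x = 2 := by omega
  have h6 : (derivative P).rootMultiplicity x = 1 := by omega
  rw [h4, h5, h6] at h2
  push_cast at h2
  linear_combination h2

/-- By the multiplicity count a critical point away from `p` and the `d i` lies over `0` or `1`; not
being a root of `P`, it is a root of `1 - P`. -/
theorem two_mul_eq_one_of_critical (h : IsPolynomialReduction d θ p e₀ e₁ P) {x : ℂ}
    (hx : ∀ i, x ≠ d i) (hxp : x ≠ p) (hroot : P.rootMultiplicity x = 0)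
    (hcrit : (derivative P).eval x = 0) : 2 * e₁ = 1 := by
  refine h.swap.two_mul_eq_one_of_root hx hxp ?_
  have h1 := h.rootMultiplicity_identity x
  have h2 := (rootMultiplicity_pos h.derivative_ne_zero).mpr hcrit
  simp only [(hx _).symm, hxp.symm, if_false, Finset.sum_const_zero] at h1
  omega

/-- The multiplicities at the points `d i ≠ p`. -/
theorem simple_root (h : IsPolynomialReduction d θ p e₀ e₁ P) {i : Fin 3} (hp : p ≠ d i) :
    (P.rootMultiplicity (d i) = 1 ∧ θ i = e₀) ∨
      (P.rootMultiplicity (d i) = 0 ∧ θ i = e₁) := by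
  have h1 := h.rootMultiplicity_identity (d i)
  have h2 := h.residue (d i)
  rw [h.sum_ite_eq] at h1 h2
  rw [if_neg hp] at h1
  by_cases hμ : P.rootMultiplicity (d i) = 0
  · right
    refine ⟨hμ, ?_⟩
    have hν : (1 - P).rootMultiplicity (d i) ≠ 0 := by omega
    have h3 := h.rootMultiplicity_derivative_of_one_sub_root hν
    have h4 : (1 - P).rootMultiplicity (d i) = 1 := by omega
    have h5 : (derivative P).rootMultiplicity (d i) = 0 := by omega
    rw [hμ, h4, h5] at h2
    push_cast at h2
    linear_combination -h2
  · left
    obtain ⟨h3, h4⟩ := h.rootMultiplicity_derivative_of_root hμ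
    have h5 : P.rootMultiplicity (d i) = 1 := by omega
    have h6 : (derivative P).rootMultiplicity (d i) = 0 := by omega
    refine ⟨h5, ?_⟩
    rw [h4, h5, h6] at h2
    push_cast at h2
    linear_combination -h2

/-- The multiplicities at `p` if `p` is one of the `d i`. -/
theorem double_root (h : IsPolynomialReduction d θ p e₀ e₁ P) {i : Fin 3} (hp : p = d i)
    (hroot : P.rootMultiplicity p ≠ 0) :
    P.rootMultiplicity p = 2 ∧ θ i = 2 * e₀ - 1 ∧ 2 * e₀ ≠ 1 := by
  have hne := h.exponent_ne_zero i hp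
  have h1 := h.rootMultiplicity_identity p
  have h2 := h.residue p
  obtain ⟨h3, h4⟩ := h.rootMultiplicity_derivative_of_root hroot
  rw [if_pos rfl] at h1
  rw [hp] at *
  rw [h.sum_ite_eq] at h1 h2
  -- `2(μ - 1) + 1 = 1 + μ`.
  have h5 : P.rootMultiplicity (d i) = 2 := by omega
  have h6 : (derivative P).rootMultiplicity (d i) = 1 := by omega
  rw [h4, h5, h6] at h2
  push_cast at h2
  have h7 : θ i = 2 * e₀ - 1 := by linear_combination -h2
  exact ⟨h5, h7, fun h8 => hne (by rw [h7, h8, sub_self])⟩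

/-- The multiplicities at `p` if `p` is none of the `d i`. -/
theorem triple_root (h : IsPolynomialReduction d θ p e₀ e₁ P) (hp : ∀ i, p ≠ d i)
    (hroot : P.rootMultiplicity p ≠ 0) : P.rootMultiplicity p = 3 ∧ e₀ = 2 / 3 := by
  have h1 := h.rootMultiplicity_identity p
  have h2 := h.residue p
  obtain ⟨h3, h4⟩ := h.rootMultiplicity_derivative_of_root hroot
  simp only [(hp _).symm, if_false, if_true, Finset.sum_const_zero] at h1 h2
  -- `2(μ - 1) = 1 + μ`; the residue `3e₀ - 2` vanishes because `p` is none of the `d i`.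
  have h5 : P.rootMultiplicity p = 3 := by omega
  have h6 : (derivative P).rootMultiplicity p = 2 := by omega
  refine ⟨h5, ?_⟩
  rw [h4, h5, h6] at h2
  push_cast at h2
  linear_combination h2 / 3

/-- If `P(p)` were neither `0` nor `1`, then for `p = d i` the order of `P'` at `p` is `0`, whence
the forbidden `θ i = 0`; for other `p`, twice that order would be `1`. -/
theorem root_or_one_sub_root (h : IsPolynomialReduction d θ p e₀ e₁ P) :
    P.rootMultiplicity p ≠ 0 ∨ (1 - P).rootMultiplicity p ≠ 0 := by
  by_contra! hcon
  have h1 := h.rootMultiplicity_identity p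
  have h2 := h.residue p
  by_cases hp : ∃ i, p = d i
  · obtain ⟨i, hi⟩ := hp
    have hne := h.exponent_ne_zero i hi
    rw [hcon.1, hcon.2, if_pos rfl] at h1
    rw [hcon.1, hcon.2] at h2
    rw [hi, h.sum_ite_eq] at h1 h2
    have h3 : (derivative P).rootMultiplicity (d i) = 0 := by omega
    rw [h3] at h2
    exact hne (by simpa using h2.symm)
  · push Not at hp
    simp only [(hp _).symm, if_false, if_true, Finset.sum_const_zero] at h1
    omega

end IsPolynomialReduction

/-! ### The three subcases in which `p` is one of the `d i`. -/

theorem coeffs_eq_zero_of_sextic_eq_zero {a₀ a₁ a₂ a₃ a₄ a₅ a₆ : ℂ}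
    (h : ∀ x : ℂ, a₆ * x ^ 6 + a₅ * x ^ 5 + a₄ * x ^ 4 + a₃ * x ^ 3 + a₂ * x ^ 2 + a₁ * x + a₀ = 0) :
    a₀ = 0 ∧ a₁ = 0 ∧ a₂ = 0 ∧ a₃ = 0 ∧ a₄ = 0 ∧ a₅ = 0 ∧ a₆ = 0 := by
  have hp : C a₆ * X ^ 6 + C a₅ * X ^ 5 + C a₄ * X ^ 4 + C a₃ * X ^ 3 + C a₂ * X ^ 2 + C a₁ * X +
      C a₀ = 0 := Polynomial.funext fun x => by simpa using h x
  have hc := fun n => congrArg (fun f => coeff f n) hp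
  refine ⟨by simpa [coeff_X, coeff_C] using hc 0, by simpa [coeff_X, coeff_C] using hc 1,
    by simpa [coeff_X, coeff_C] using hc 2, by simpa [coeff_X, coeff_C] using hc 3,
    by simpa [coeff_X, coeff_C] using hc 4, by simpa [coeff_X, coeff_C] using hc 5,
    by simpa [coeff_X, coeff_C] using hc 6⟩

namespace IsPolynomialReduction

variable {d θ : Fin 3 → ℂ} {p e₀ e₁ : ℂ} {P : ℂ[X]}

theorem leadingCoeff_ne_zero (h : IsPolynomialReduction d θ p e₀ e₁ P) : P.leadingCoeff ≠ 0 :=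
  Polynomial.leadingCoeff_ne_zero.mpr h.ne_zero

theorem d_ne (h : IsPolynomialReduction d θ p e₀ e₁ P) :
    d 0 ≠ d 1 ∧ d 0 ≠ d 2 ∧ d 1 ≠ d 2 :=
  ⟨h.injective.ne (by decide), h.injective.ne (by decide), h.injective.ne (by decide)⟩

/-- The factorization of `P` if its roots are among the `d i`. -/
theorem eq_prod_of_double_root (h : IsPolynomialReduction d θ p e₀ e₁ P) (hp : p = d 1)
    (hroot : P.rootMultiplicity p ≠ 0) :
    P = C P.leadingCoeff * ((X - C (d 1)) ^ 2 * (X - C (d 0)) ^ P.rootMultiplicity (d 0) *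
      (X - C (d 2)) ^ P.rootMultiplicity (d 2)) := by
  obtain ⟨h1, -, h2⟩ := h.double_root hp hroot
  have := eq_C_mul_prod_of_roots h.injective (P := P) fun x hx => by
    by_contra! hcon
    exact h2 (h.two_mul_eq_one_of_root hcon (hp ▸ hcon 1) hx)
  rw [Fin.prod_univ_three, ← hp, h1, hp] at this
  exact this.trans (by ring)

/-- Here `P = c (s - d 1)²` and `1 - P` vanishes at `d 0` and `d 2`, so `d 1` is their midpoint. -/
theorem isStandard_harmonicQuadratic (h : IsPolynomialReduction d θ p e₀ e₁ P) (hp : p = d 1)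
    (hroot : P.rootMultiplicity p ≠ 0) (h0 : P.rootMultiplicity (d 0) = 0)
    (h2 : P.rootMultiplicity (d 2) = 0) : IsStandardReduction d θ p P := by
  obtain ⟨κ, hκ, hid⟩ := h.exists_identity
  obtain ⟨h01, h02, h12⟩ := h.d_ne
  have hc := h.leadingCoeff_ne_zero
  have hP := h.eq_prod_of_double_root hp hroot
  simp only [h0, h2, pow_zero, mul_one] at hP
  have hθ0 : θ 0 = e₁ := ((h.simple_root (hp ▸ h01.symm)).resolve_left (by simp [h0])).2
  have hθ2 : θ 2 = e₁ := ((h.simple_root (hp ▸ h12)).resolve_left (by simp [h2])).2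
  set c := P.leadingCoeff
  have hP' : derivative P = C c * (2 * (X - C (d 1))) := by
    rw [hP]; simp only [derivative_C, derivative_mul, derivative_X_sub_C_pow,
      Nat.cast_ofNat, map_ofNat]; ring
  -- Both sides of `hid` are divisible by `(X - p) P`. Cancelling it leaves a factorization of `1 -
  -- P`; the other six cases use the same cancellation.
  have hcan : C κ * C c * 4 * ((X - C (d 0)) * (X - C (d 2))) = 1 - P := by
    refine mul_left_cancel₀ (a := C c * (X - C (d 1)) ^ 3)
      (mul_ne_zero (C_ne_zero.mpr hc) (pow_ne_zero _ (X_sub_C_ne_zero _))) ?_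
    rw [hP', Fin.prod_univ_three, hp] at hid
    linear_combination hid + (X - C (d 1)) * (1 - P) * hP
  have H : ∀ x, κ * c * 4 * ((x - (d 0 - d 1)) * (x - (d 2 - d 1))) = 1 - c * x ^ 2 := fun x => by
    have := congrArg (eval (x + d 1)) hcan
    rw [hP] at this
    simp at this
    linear_combination this
  obtain ⟨c0, c1, c2, -⟩ := coeffs_eq_zero_of_sextic_eq_zero
    (a₀ := κ * c * 4 * ((d 0 - d 1) * (d 2 - d 1)) - 1)
    (a₁ := - (κ * c * 4 * ((d 0 - d 1) + (d 2 - d 1)))) (a₂ := κ * c * 4 + c)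
    (a₃ := 0) (a₄ := 0) (a₅ := 0) (a₆ := 0) fun x => by linear_combination H x
  have hd0 : d 0 - d 1 = - (d 2 - d 1) := by
    have : κ * c * 4 ≠ 0 := by simp [hκ, hc]
    have := (mul_eq_zero.mp (neg_eq_zero.mp c1)).resolve_left this
    linear_combination this
  have hu : d 2 - d 1 ≠ 0 := sub_ne_zero.mpr h12.symm
  have hcu : c = 1 / (d 2 - d 1) ^ 2 := by
    rw [eq_div_iff (pow_ne_zero _ hu)]
    rw [hd0] at c0
    linear_combination c0 + (d 2 - d 1) ^ 2 * c2
  -- The affine map takes `d 1, d 2` to `1, 2`. The reflected alternative is needed because `P(p) =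
  -- 0` whereas this `R₁` takes the value `1` at `p₀`.
  refine IsStandardReduction.of_affine .harmonicQuadratic (1 / (d 2 - d 1))
    (1 - d 1 / (d 2 - d 1)) ?_ ?_ ?_ ?_ ?_ (Or.inr fun s => ?_)
  · field_simp; linear_combination hd0
  · field_simp; ring
  · simp only [ReductionType.D]; field_simp; ring
  · simp only [ReductionType.ExponentCondition]; rw [hθ0, hθ2]
  · simp only [ReductionType.p₀, hp]; field_simp; ring
  · rw [hP, hcu]
    simp [ReductionType.R₁]
    field_simp
    ring

/-- Here `P = c (s - d 1)² (s - d 2)`. Over `1` lie the simple point `d 0` and, doubly, the second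
critical point of `P`; the latter forces `e₁ = 1/2`. -/
theorem isStandard_collinearCubic (h : IsPolynomialReduction d θ p e₀ e₁ P) (hp : p = d 1)
    (hroot : P.rootMultiplicity p ≠ 0) (h0 : P.rootMultiplicity (d 0) = 0)
    (h2 : P.rootMultiplicity (d 2) ≠ 0) : IsStandardReduction d θ p P := by
  obtain ⟨κ, hκ, hid⟩ := h.exists_identity
  obtain ⟨h01, h02, h12⟩ := h.d_ne
  have hc := h.leadingCoeff_ne_zero
  have hP := h.eq_prod_of_double_root hp hroot
  have hθ0 : θ 0 = e₁ := ((h.simple_root (hp ▸ h01.symm)).resolve_left (by simp [h0])).2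
  obtain ⟨h2', hθ2⟩ := (h.simple_root (i := 2) (hp ▸ h12)).resolve_right (by simp [h2])
  have hθ1 := (h.double_root hp hroot).2.1
  rw [h0, h2', pow_zero, mul_one, pow_one] at hP
  set c := P.leadingCoeff
  have hP' : derivative P = C c * ((X - C (d 1)) * (3 * X - 2 * C (d 2) - C (d 1))) := by
    rw [hP]; simp only [derivative_C, derivative_mul, derivative_X_sub_C_pow, derivative_X_sub_C,
      Nat.cast_ofNat, map_ofNat]; ring
  have hcan : C κ * C c * ((3 * X - 2 * C (d 2) - C (d 1)) ^ 2 * (X - C (d 0))) = 1 - P := by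
    refine mul_left_cancel₀ (a := C c * ((X - C (d 1)) ^ 3 * (X - C (d 2))))
      (mul_ne_zero (C_ne_zero.mpr hc) (mul_ne_zero (pow_ne_zero _ (X_sub_C_ne_zero _))
        (X_sub_C_ne_zero _))) ?_
    rw [hP', Fin.prod_univ_three, hp] at hid
    linear_combination hid + (X - C (d 1)) * (1 - P) * hP
  have hu : d 2 - d 1 ≠ 0 := sub_ne_zero.mpr h12.symm
  obtain ⟨u, hu'⟩ : ∃ u, d 2 = d 1 + u := ⟨d 2 - d 1, by ring⟩
  obtain ⟨v, hv'⟩ : ∃ v, d 0 = d 1 + v := ⟨d 0 - d 1, by ring⟩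
  rw [hu', add_sub_cancel_left] at hu
  have H : ∀ x, κ * c * ((3 * x - 2 * u) ^ 2 * (x - v)) = 1 - c * x ^ 2 * (x - u) := fun x => by
    have := congrArg (eval (x + d 1)) hcan
    rw [hP, hu', hv'] at this
    simp at this
    linear_combination this
  obtain ⟨c0, -, c2, c3, -⟩ := coeffs_eq_zero_of_sextic_eq_zero
    (a₀ := - (κ * c * 4 * u ^ 2 * v) - 1)
    (a₁ := κ * c * (4 * u ^ 2 + 12 * u * v)) (a₂ := - κ * c * (12 * u + 9 * v) - c * u)
    (a₃ := 9 * κ * c + c) (a₄ := 0) (a₅ := 0) (a₆ := 0) fun x => by linear_combination H x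
  have hv : v = - u / 3 := mul_left_cancel₀ hc (by
    linear_combination c2 + (12 * u + 9 * v) / 9 * c3)
  have hcu : c = -27 / (4 * u ^ 3) := by
    rw [eq_div_iff (by simpa using hu)]
    rw [hv] at c0
    linear_combination -27 * c0 + 4 * u ^ 3 * c3
  -- The point used is the zero of the factor `3x - 2u` of `P'`, with `x` measured from `d 1`.
  have he₁ : 2 * e₁ = 1 := by
    refine h.two_mul_eq_one_of_critical (x := d 1 + 2 * u / 3) (fun i hi => hu ?_)
      (fun hi => hu ?_) (rootMultiplicity_eq_zero fun hi => ?_) ?_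
    · fin_cases i
      · have : d 1 + 2 * u / 3 = d 0 := hi
        rw [hv', hv] at this
        linear_combination this
      · have : d 1 + 2 * u / 3 = d 1 := hi
        linear_combination 3 / 2 * this
      · have : d 1 + 2 * u / 3 = d 2 := hi
        rw [hu'] at this
        linear_combination -3 * this
    · rw [hp] at hi; linear_combination 3 / 2 * hi
    · rw [IsRoot.def, hP, hu', hcu] at hi
      simp at hi
      field_simp at hi
      norm_num at hi
      exact hu hi
    · rw [hP', hu']
      simp
      right; right; ring
  refine IsStandardReduction.of_affine .collinearCubic (3 / u)
    (1 - 3 * d 1 / u) ?_ ?_ ?_ ?_ ?_ (Or.inl fun s => ?_)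
  · rw [hv', hv]; field_simp; ring
  · field_simp; ring
  · rw [hu']; simp only [ReductionType.D]; field_simp; ring
  · simp only [ReductionType.ExponentCondition]; rw [hθ0, hθ1, hθ2]
    exact ⟨by ring, by linear_combination he₁ / 2⟩
  · simp only [ReductionType.p₀, hp]; field_simp; ring
  · rw [hP, hcu, hu']
    simp [ReductionType.R₁]
    field_simp
    ring

/-- All three `d i` lie over `0`, so `1 - P` is a constant times a square; its two top coefficients
make `d 0` and `d 2` symmetric about `d 1`. -/
theorem isStandard_harmonicQuartic (h : IsPolynomialReduction d θ p e₀ e₁ P) (hp : p = d 1)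
    (hroot : P.rootMultiplicity p ≠ 0) (h0 : P.rootMultiplicity (d 0) ≠ 0)
    (h2 : P.rootMultiplicity (d 2) ≠ 0) : IsStandardReduction d θ p P := by
  obtain ⟨κ, hκ, hid⟩ := h.exists_identity
  obtain ⟨h01, h02, h12⟩ := h.d_ne
  have hc := h.leadingCoeff_ne_zero
  have hP := h.eq_prod_of_double_root hp hroot
  obtain ⟨h0', hθ0⟩ := (h.simple_root (i := 0) (hp ▸ h01.symm)).resolve_right (by simp [h0])
  obtain ⟨h2', hθ2⟩ := (h.simple_root (i := 2) (hp ▸ h12)).resolve_right (by simp [h2])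
  have hθ1 := (h.double_root hp hroot).2.1
  rw [h0', h2', pow_one, pow_one] at hP
  set c := P.leadingCoeff
  have hP' : derivative P = C c * ((X - C (d 1)) * (2 * (X - C (d 0)) * (X - C (d 2)) +
      (X - C (d 1)) * (2 * X - C (d 0) - C (d 2)))) := by
    rw [hP]; simp only [derivative_C, derivative_mul, derivative_X_sub_C_pow, derivative_X_sub_C,
      Nat.cast_ofNat, map_ofNat]; ring
  have hcan : C κ * C c * (2 * (X - C (d 0)) * (X - C (d 2)) +
      (X - C (d 1)) * (2 * X - C (d 0) - C (d 2))) ^ 2 = 1 - P := by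
    refine mul_left_cancel₀ (a := C c * ((X - C (d 1)) ^ 3 * (X - C (d 0)) * (X - C (d 2))))
      (mul_ne_zero (C_ne_zero.mpr hc) (mul_ne_zero (mul_ne_zero
        (pow_ne_zero _ (X_sub_C_ne_zero _)) (X_sub_C_ne_zero _)) (X_sub_C_ne_zero _))) ?_
    rw [hP', Fin.prod_univ_three, hp] at hid
    linear_combination hid + (X - C (d 1)) * (1 - P) * hP
  have hu : d 2 - d 1 ≠ 0 := sub_ne_zero.mpr h12.symm
  obtain ⟨u, hu'⟩ : ∃ u, d 2 = d 1 + u := ⟨d 2 - d 1, by ring⟩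
  obtain ⟨v, hv'⟩ : ∃ v, d 0 = d 1 + v := ⟨d 0 - d 1, by ring⟩
  rw [hu', add_sub_cancel_left] at hu
  have H : ∀ x, κ * c * (4 * x ^ 2 - 3 * (u + v) * x + 2 * u * v) ^ 2 =
      1 - c * x ^ 2 * (x - u) * (x - v) := fun x => by
    have := congrArg (eval (x + d 1)) hcan
    rw [hP, hu', hv'] at this
    simp at this
    linear_combination this
  obtain ⟨c0, -, -, c3, c4, -⟩ := coeffs_eq_zero_of_sextic_eq_zero
    (a₀ := κ * c * 4 * u ^ 2 * v ^ 2 - 1)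
    (a₁ := - κ * c * 12 * (u + v) * u * v)
    (a₂ := κ * c * (9 * (u + v) ^ 2 + 16 * u * v) + c * u * v)
    (a₃ := - 24 * κ * c * (u + v) - c * (u + v)) (a₄ := 16 * κ * c + c) (a₅ := 0) (a₆ := 0)
    fun x => by linear_combination H x
  have hv : v = - u := mul_left_cancel₀ hc (by
    linear_combination 2 * c3 + 3 * (u + v) * c4)
  have hcu : c = -4 / u ^ 4 := by
    rw [eq_div_iff (by simpa using hu)]
    rw [hv] at c0
    linear_combination u ^ 4 * c4 - 4 * c0
  refine IsStandardReduction.of_affine .harmonicQuartic (1 / u)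
    (1 - d 1 / u) ?_ ?_ ?_ ?_ ?_ (Or.inr fun s => ?_)
  · rw [hv', hv]; field_simp; ring
  · field_simp; ring
  · rw [hu']; simp only [ReductionType.D]; field_simp; ring
  · simp only [ReductionType.ExponentCondition]; rw [hθ0, hθ1, hθ2]
    exact ⟨rfl, by ring⟩
  · simp only [ReductionType.p₀, hp]; field_simp; ring
  · rw [hP, hcu, hu', hv', hv]
    simp [ReductionType.R₁]
    field_simp
    ring

end IsPolynomialReduction

/-! ### Placing the triple-root solutions on the model triangles. -/

theorem Complex.I_mul_sqrt_sq {x : ℝ} (hx : 0 ≤ x) : (Complex.I * (Real.sqrt x : ℂ)) ^ 2 = -x := by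
  rw [mul_pow, Complex.I_sq, ← Complex.ofReal_pow, Real.sq_sqrt hx, neg_one_mul]

/-- If `u ≠ v`, the third vertex `-(u + v)`, in the coordinate sending `u, v` to `0, 1`, is a root
of `D² - D + 1`. Exchanging `u` and `v` replaces `D` by `1 - D`, the other root; hence the product
of the two differences vanishes. -/
theorem equilateral_orientation {w u v : ℂ} (hw : w ^ 2 = -3) (huv : u ^ 2 + u * v + v ^ 2 = 0) :
    -(u + v) - u = (1 / 2 + w / 2) * (v - u) ∨ -(v + u) - v = (1 / 2 + w / 2) * (u - v) := by
  rw [← sub_eq_zero, ← sub_eq_zero (a := -(v + u) - v), ← mul_eq_zero]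
  linear_combination 3 * huv - (v - u) ^ 2 / 4 * hw

section
open ReductionType

variable {d θ : Fin 3 → ℂ} {p c : ℂ} {P : ℂ[X]}

theorem isStandardReduction_equianharmonicCubic (hP : ∀ s, P.eval s = c * (s - p) ^ 3)
    {u v : ℂ} (h0 : d 0 = p + u) (h1 : d 1 = p + v) (h2 : d 2 = p - (u + v)) (huv : u ≠ v)
    (hc : c * u ^ 3 = 1)
    (hD : -(u + v) - u = (1 / 2 + Complex.I * (Real.sqrt 3 : ℂ) / 2) * (v - u))
    (hθ0 : θ 0 = θ 1) (hθ1 : θ 1 = θ 2) : IsStandardReduction d θ p P := by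
  have hk : v - u ≠ 0 := sub_ne_zero.mpr huv.symm
  have hu : u ≠ 0 := by rintro rfl; simp at hc
  have hD' : equianharmonicCubic.D = (-(u + v) - u) / (v - u) := by
    rw [eq_div_iff hk, D]
    linear_combination -hD
  have hp : equianharmonicCubic.p₀ = -u / (v - u) := by
    rw [eq_div_iff hk, p₀]
    linear_combination -1 / 3 * hD
  have hcu : c = 1 / u ^ 3 := by rw [eq_div_iff (pow_ne_zero 3 hu), hc]
  refine IsStandardReduction.of_affine .equianharmonicCubic (1 / (v - u)) (-(p + u) / (v - u))
    ?_ ?_ ?_ ⟨hθ0, hθ1⟩ ?_ (Or.inl fun s => ?_)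
  · rw [h0]; field_simp; ring
  · rw [h1]; field_simp; ring
  · rw [h2, hD']; field_simp; ring
  · rw [hp]; field_simp; ring
  · rw [hP, R₁, hp, hcu]
    simp
    field_simp
    ring

theorem isStandardReduction_isoscelesQuartic
    (hP : ∀ s, P.eval s = c * ((s - p) ^ 3 * (s - d 2))) {u v δ : ℂ} (h0 : d 0 = p + u)
    (h1 : d 1 = p + v) (h2 : d 2 = p + δ) (hsum : u + v = -δ / 2)
    (hc : c * (u ^ 3 * (u - δ)) = 1) (huv : u ≠ v)
    (hδ : δ = Complex.I * (Real.sqrt 2 : ℂ) * (v - u))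
    (hθ0 : θ 0 = 1 / 2) (hθ1 : θ 1 = 1 / 2) (hθ2 : θ 2 = 2 / 3) : IsStandardReduction d θ p P := by
  have hk : v - u ≠ 0 := sub_ne_zero.mpr huv.symm
  have hu : u ≠ 0 := by rintro rfl; simp at hc
  have huδ : δ - u ≠ 0 := by
    intro h; rw [← neg_sub δ, h] at hc; simp at hc
  have hp : isoscelesQuartic.p₀ = -u / (v - u) := by
    rw [eq_div_iff hk, p₀]
    linear_combination 1 / 2 * hsum - 1 / 4 * hδ
  have hD : isoscelesQuartic.D = (δ - u) / (v - u) := by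
    rw [eq_div_iff hk, D]
    linear_combination 1 / 2 * hsum - 5 / 4 * hδ
  have hcu : c = -1 / (u ^ 3 * (δ - u)) := by
    rw [eq_div_iff (mul_ne_zero (pow_ne_zero 3 hu) huδ)]
    linear_combination -hc
  refine IsStandardReduction.of_affine .isoscelesQuartic (1 / (v - u)) (-(p + u) / (v - u))
    ?_ ?_ ?_ ⟨hθ0, hθ1, hθ2⟩ ?_ (Or.inl fun s => ?_)
  · rw [h0]; field_simp; ring
  · rw [h1]; field_simp; ring
  · rw [h2, hD]; field_simp; ring
  · rw [hp]; field_simp; ring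
  · rw [hP, R₁, hp, hD, hcu, h2]
    simp
    field_simp
    ring

theorem isStandardReduction_isoscelesQuintic
    (hP : ∀ s, P.eval s = c * ((s - p) ^ 3 * (s - d 0) * (s - d 1))) {u v δ : ℂ} (h0 : d 0 = p + u)
    (h1 : d 1 = p + v) (h2 : d 2 = p + δ) (hsum : u + v = -5 * δ / 3)
    (hc : c * δ ^ 5 * 64 = 9) (huv : u ≠ v)
    (hδ : δ = Complex.I * (Real.sqrt 15 : ℂ) / 15 * (v - u))
    (hθ0 : θ 0 = 2 / 3) (hθ1 : θ 1 = 2 / 3) (hθ2 : θ 2 = 1 / 2) : IsStandardReduction d θ p P := by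
  have hk : v - u ≠ 0 := sub_ne_zero.mpr huv.symm
  have hw := Complex.I_mul_sqrt_sq (x := 15) (by norm_num)
  push_cast at hw
  have hp : isoscelesQuintic.p₀ = -u / (v - u) := by
    rw [eq_div_iff hk, p₀]
    linear_combination 1 / 2 * hsum - 5 / 6 * hδ
  have hD : isoscelesQuintic.D = (δ - u) / (v - u) := by
    rw [eq_div_iff hk, D]
    linear_combination 1 / 2 * hsum - 11 / 6 * hδ
  have hC : -Complex.I * (2025 * (Real.sqrt 15 : ℂ)) / 64 = c * (v - u) ^ 5 := by
    have h0 : δ ^ 5 ≠ 0 := by intro h; simp [h] at hc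
    refine mul_right_cancel₀ h0 ?_
    -- From `w² = -15` one gets `w⁵ = 225 w`; together with `hc` this turns `c (v - u)⁵` into the
    -- stated constant.
    have h1 : δ ^ 5 = 225 / 15 ^ 5 * (Complex.I * (Real.sqrt 15 : ℂ)) * (v - u) ^ 5 := by
      generalize Complex.I * (Real.sqrt 15 : ℂ) = w at hw hδ ⊢
      have h4 : w ^ 4 = 225 := by linear_combination (w ^ 2 - 15) * hw
      rw [hδ]
      linear_combination w * (v - u) ^ 5 / 15 ^ 5 * h4
    linear_combination -2025 / 64 * (Complex.I * (Real.sqrt 15 : ℂ)) * h1 -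
      2025 / 64 * (225 / 15 ^ 5) * (v - u) ^ 5 * hw - 1 / 64 * (v - u) ^ 5 * hc
  refine IsStandardReduction.of_affine .isoscelesQuintic (1 / (v - u)) (-(p + u) / (v - u))
    ?_ ?_ ?_ ⟨hθ0, hθ1, hθ2⟩ ?_ (Or.inl fun s => ?_)
  · rw [h0]; field_simp; ring
  · rw [h1]; field_simp; ring
  · rw [h2, hD]; field_simp; ring
  · rw [hp]; field_simp; ring
  · rw [hP, R₁, hp, hC, h0, h1]
    simp only [eval_mul, eval_C, eval_pow, eval_sub, eval_X, eval_one]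
    field_simp
    ring

theorem isStandardReduction_equianharmonicSextic {u v : ℂ}
    (hP : ∀ s, P.eval s = c * ((s - p) ^ 3 * ((s - p) ^ 3 - u ^ 3)))
    (h0 : d 0 = p + u) (h1 : d 1 = p + v) (h2 : d 2 = p - (u + v)) (huv : u ≠ v)
    (hc : c * u ^ 6 = -4)
    (hD : -(u + v) - u = (1 / 2 + Complex.I * (Real.sqrt 3 : ℂ) / 2) * (v - u))
    (hθ0 : θ 0 = 2 / 3) (hθ1 : θ 1 = 2 / 3) (hθ2 : θ 2 = 2 / 3) : IsStandardReduction d θ p P := by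
  have hk : v - u ≠ 0 := sub_ne_zero.mpr huv.symm
  have hu : u ≠ 0 := by rintro rfl; simp at hc
  have hD' : equianharmonicSextic.D = (-(u + v) - u) / (v - u) := by
    rw [eq_div_iff hk, D]
    linear_combination -hD
  have hp : equianharmonicSextic.p₀ = -u / (v - u) := by
    rw [eq_div_iff hk, p₀]
    linear_combination -1 / 3 * hD
  have hcu : c = -4 / u ^ 6 := by rw [eq_div_iff (pow_ne_zero 6 hu), hc]
  refine IsStandardReduction.of_affine .equianharmonicSextic (1 / (v - u)) (-(p + u) / (v - u))
    ?_ ?_ ?_ ⟨hθ0, hθ1, hθ2⟩ ?_ (Or.inr fun s => ?_)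
  · rw [h0]; field_simp; ring
  · rw [h1]; field_simp; ring
  · rw [h2, hD']; field_simp; ring
  · rw [hp]; field_simp; ring
  · rw [hP, R₁, hp, hcu]
    simp
    field_simp
    ring

end

/-! ### The four subcases in which `p` is none of the `d i`. -/

namespace IsPolynomialReduction

variable {d θ : Fin 3 → ℂ} {p e₀ e₁ : ℂ} {P : ℂ[X]}

/-- The factorization of `P` if `p` is a triple root. -/
theorem eq_prod_of_triple_root (h : IsPolynomialReduction d θ p e₀ e₁ P) (hp : ∀ i, p ≠ d i)
    (hroot : P.rootMultiplicity p ≠ 0) :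
    P = C P.leadingCoeff * ((X - C p) ^ 3 * (X - C (d 0)) ^ P.rootMultiplicity (d 0) *
      (X - C (d 1)) ^ P.rootMultiplicity (d 1) * (X - C (d 2)) ^ P.rootMultiplicity (d 2)) := by
  obtain ⟨h1, h2⟩ := h.triple_root hp hroot
  have hinj : Function.Injective (Fin.cons p d : Fin 4 → ℂ) :=
    Fin.cons_injective_iff.mpr ⟨fun ⟨i, hi⟩ => hp i hi.symm, h.injective⟩
  have := eq_C_mul_prod_of_roots hinj (P := P) fun x hx => by
    by_contra! hcon
    have h3 := h.two_mul_eq_one_of_root (fun i => hcon i.succ) (hcon 0) hx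
    rw [h2] at h3
    norm_num at h3
  rw [Fin.prod_univ_succ, Fin.prod_univ_three] at this
  simp only [Fin.cons_zero, Fin.cons_succ, h1] at this
  exact this.trans (by ring)

theorem exists_eq_add (a b : ℂ) : ∃ u, a = b + u := ⟨a - b, by ring⟩

/-- Here `P = c (s - p)³`, so the numbers `d i - p` are the three cube roots of `1/c`: an
equilateral triangle with centre `p`. -/
theorem isStandard_equianharmonicCubic (h : IsPolynomialReduction d θ p e₀ e₁ P)
    (hp : ∀ i, p ≠ d i) (hroot : P.rootMultiplicity p ≠ 0) (h0 : P.rootMultiplicity (d 0) = 0)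
    (h1 : P.rootMultiplicity (d 1) = 0) (h2 : P.rootMultiplicity (d 2) = 0) :
    IsStandardReduction d θ p P := by
  obtain ⟨κ, hκ, hid⟩ := h.exists_identity
  obtain ⟨h01, -, -⟩ := h.d_ne
  have hc := h.leadingCoeff_ne_zero
  have hP := h.eq_prod_of_triple_root hp hroot
  have hθ0 : θ 0 = e₁ := ((h.simple_root (hp 0)).resolve_left (by simp [h0])).2
  have hθ1 : θ 1 = e₁ := ((h.simple_root (hp 1)).resolve_left (by simp [h1])).2
  have hθ2 : θ 2 = e₁ := ((h.simple_root (hp 2)).resolve_left (by simp [h2])).2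
  simp only [h0, h1, h2, pow_zero, mul_one] at hP
  set c := P.leadingCoeff
  have hP' : derivative P = C c * (3 * (X - C p) ^ 2) := by
    rw [hP]; simp only [derivative_C, derivative_mul, derivative_X_sub_C_pow,
      Nat.cast_ofNat, map_ofNat]; ring
  have hcan : C κ * C c * 9 * ((X - C (d 0)) * (X - C (d 1)) * (X - C (d 2))) = 1 - P := by
    refine mul_left_cancel₀ (a := C c * (X - C p) ^ 4)
      (mul_ne_zero (C_ne_zero.mpr hc) (pow_ne_zero _ (X_sub_C_ne_zero _))) ?_
    rw [hP', Fin.prod_univ_three] at hid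
    linear_combination hid + (X - C p) * (1 - P) * hP
  obtain ⟨u, hu⟩ := exists_eq_add (d 0) p
  obtain ⟨v, hv⟩ := exists_eq_add (d 1) p
  obtain ⟨r, hr⟩ := exists_eq_add (d 2) p
  have H : ∀ x, κ * c * 9 * ((x - u) * (x - v) * (x - r)) = 1 - c * x ^ 3 := fun x => by
    have := congrArg (eval (x + p)) hcan
    rw [hP, hu, hv, hr] at this
    simp at this
    linear_combination this
  obtain ⟨c0, c1, c2, c3, -⟩ := coeffs_eq_zero_of_sextic_eq_zero
    (a₀ := -(κ * c * 9 * (u * v * r)) - 1) (a₁ := κ * c * 9 * (u * v + u * r + v * r))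
    (a₂ := -(κ * c * 9 * (u + v + r))) (a₃ := κ * c * 9 + c)
    (a₄ := 0) (a₅ := 0) (a₆ := 0) fun x => by linear_combination H x
  have hr' : r = -(u + v) := mul_left_cancel₀ hc (by
    linear_combination c2 + (u + v + r) * c3)
  have hq : u ^ 2 + u * v + v ^ 2 = 0 := mul_left_cancel₀ hc (by
    rw [hr'] at c1
    linear_combination c1 + (u ^ 2 + u * v + v ^ 2) * c3)
  have huv : u ≠ v := fun h => h01 (by rw [hu, hv, h])
  have hcu : c * u ^ 3 = 1 := by linear_combination H u
  have hcv : c * v ^ 3 = 1 := by linear_combination H v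
  have hPs : ∀ s, P.eval s = c * (s - p) ^ 3 := fun s => by rw [hP]; simp
  have hw := Complex.I_mul_sqrt_sq (x := 3) (by norm_num)
  push_cast at hw
  rcases equilateral_orientation hw hq with hD | hD
  · exact isStandardReduction_equianharmonicCubic hPs hu hv (by rw [hr, hr']; ring) huv hcu hD
      (by rw [hθ0, hθ1]) (by rw [hθ1, hθ2])
  · refine .of_comp (Equiv.swap 0 1) (isStandardReduction_equianharmonicCubic hPs
      (u := v) (v := u) ?_ ?_ ?_ huv.symm hcv hD ?_ ?_)
    · simpa using hv
    · simpa using hu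
    · rw [Function.comp_apply, Equiv.swap_apply_of_ne_of_ne (by decide) (by decide), hr, hr']; ring
    · simp [hθ0, hθ1]
    · simp [hθ0, hθ2, Equiv.swap_apply_of_ne_of_ne]

/-- Here `P = c (s - p)³ (s - d 2)` has one further critical point, `p + 3δ/4`. It lies over `1` and
forces `e₁ = 1/2`. -/
theorem isStandard_isoscelesQuartic (h : IsPolynomialReduction d θ p e₀ e₁ P)
    (hp : ∀ i, p ≠ d i) (hroot : P.rootMultiplicity p ≠ 0) (h0 : P.rootMultiplicity (d 0) = 0)
    (h1 : P.rootMultiplicity (d 1) = 0) (h2 : P.rootMultiplicity (d 2) ≠ 0) :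
    IsStandardReduction d θ p P := by
  obtain ⟨κ, hκ, hid⟩ := h.exists_identity
  obtain ⟨h01, -, -⟩ := h.d_ne
  have hc := h.leadingCoeff_ne_zero
  have hP := h.eq_prod_of_triple_root hp hroot
  have he₀ := (h.triple_root hp hroot).2
  have hθ0 : θ 0 = e₁ := ((h.simple_root (hp 0)).resolve_left (by simp [h0])).2
  have hθ1 : θ 1 = e₁ := ((h.simple_root (hp 1)).resolve_left (by simp [h1])).2
  obtain ⟨h2', hθ2⟩ := (h.simple_root (hp 2)).resolve_right (by simp [h2])
  simp only [h0, h1, h2', pow_zero, pow_one, mul_one] at hP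
  set c := P.leadingCoeff
  have hP' : derivative P = C c * ((X - C p) ^ 2 * (4 * X - 3 * C (d 2) - C p)) := by
    rw [hP]; simp only [derivative_C, derivative_mul, derivative_X_sub_C_pow, derivative_X_sub_C,
      Nat.cast_ofNat, map_ofNat]; ring
  have hcan : C κ * C c * ((4 * X - 3 * C (d 2) - C p) ^ 2 * ((X - C (d 0)) * (X - C (d 1)))) =
      1 - P := by
    refine mul_left_cancel₀ (a := C c * ((X - C p) ^ 4 * (X - C (d 2))))
      (mul_ne_zero (C_ne_zero.mpr hc) (mul_ne_zero (pow_ne_zero _ (X_sub_C_ne_zero _))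
        (X_sub_C_ne_zero _))) ?_
    rw [hP', Fin.prod_univ_three] at hid
    linear_combination hid + (X - C p) * (1 - P) * hP
  obtain ⟨u, hu⟩ := exists_eq_add (d 0) p
  obtain ⟨v, hv⟩ := exists_eq_add (d 1) p
  obtain ⟨δ, hδ⟩ := exists_eq_add (d 2) p
  have hδ0 : δ ≠ 0 := fun h0 => hp 2 (by rw [hδ, h0, add_zero])
  have H : ∀ x, κ * c * ((4 * x - 3 * δ) ^ 2 * ((x - u) * (x - v))) =
      1 - c * x ^ 3 * (x - δ) := fun x => by
    have := congrArg (eval (x + p)) hcan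
    rw [hP, hu, hv, hδ] at this
    simp at this
    linear_combination this
  obtain ⟨c0, c1, c2, c3, c4, -⟩ := coeffs_eq_zero_of_sextic_eq_zero
    (a₀ := κ * c * (9 * δ ^ 2 * (u * v)) - 1)
    (a₁ := -(κ * c * (9 * δ ^ 2 * (u + v) + 24 * δ * (u * v))))
    (a₂ := κ * c * (9 * δ ^ 2 + 24 * δ * (u + v) + 16 * (u * v)))
    (a₃ := -(κ * c * (24 * δ + 16 * (u + v))) - c * δ) (a₄ := 16 * κ * c + c)
    (a₅ := 0) (a₆ := 0) fun x => by linear_combination H x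
  have hsum : u + v = -δ / 2 := mul_left_cancel₀ hc (by
    linear_combination c3 + (24 * δ + 16 * (u + v)) / 16 * c4)
  have hprod : u * v = 3 * δ ^ 2 / 16 := mul_left_cancel₀ hc (by
    rw [hsum] at c2
    linear_combination (u * v - 3 * δ ^ 2 / 16) * c4 - c2)
  have huv : u ≠ v := fun h => h01 (by rw [hu, hv, h])
  have hcu : c * (u ^ 3 * (u - δ)) = 1 := by linear_combination H u
  have hcv : c * (v ^ 3 * (v - δ)) = 1 := by linear_combination H v
  have he₁ : e₁ = 1 / 2 := by
    have hne : ∀ x : ℂ, x = u ∨ x = v → p + 3 * δ / 4 ≠ p + x := by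
      intro x hx h0
      have h3 : (x - u) * (x - v) = 0 := by rcases hx with rfl | rfl <;> ring
      have h4 : x = 3 * δ / 4 := by linear_combination -h0
      rw [h4] at h3
      have h5 : δ ^ 2 = 0 := by
        linear_combination 8 / 9 * (h3 + 3 * δ / 4 * hsum - hprod)
      exact hδ0 (pow_eq_zero_iff two_ne_zero |>.mp h5)
    have : 2 * e₁ = 1 := by
      refine h.two_mul_eq_one_of_critical (x := p + 3 * δ / 4) (fun i => ?_)
        (fun hi => hδ0 (by linear_combination 4 / 3 * hi))
        (rootMultiplicity_eq_zero fun hi => ?_) ?_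
      · fin_cases i
        · change p + 3 * δ / 4 ≠ d 0
          rw [hu]; exact hne u (Or.inl rfl)
        · change p + 3 * δ / 4 ≠ d 1
          rw [hv]; exact hne v (Or.inr rfl)
        · change p + 3 * δ / 4 ≠ d 2
          rw [hδ]; exact fun hi => hδ0 (by linear_combination -4 * hi)
      · rw [IsRoot.def, hP, hδ] at hi
        simp at hi
        rcases hi with hi | hi | hi
        · exact hc hi
        · exact hδ0 hi
        · exact hδ0 (by linear_combination -4 * hi)
      · rw [hP', hδ]
        simp
        right; right; ring
    linear_combination this / 2
  have hPs : ∀ s, P.eval s = c * ((s - p) ^ 3 * (s - d 2)) := fun s => by rw [hP]; simp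
  have hw := Complex.I_mul_sqrt_sq (x := 2) (by norm_num)
  push_cast at hw
  -- The values of `u + v` and `uv` give `(v - u)² = -δ²/2`; the sign of the root is absorbed by
  -- exchanging `d 0` and `d 1`.
  have horient : δ = Complex.I * (Real.sqrt 2 : ℂ) * (v - u) ∨
      δ = Complex.I * (Real.sqrt 2 : ℂ) * (u - v) := by
    rw [← sub_eq_zero, ← sub_eq_zero (b := _ * (u - v)), ← mul_eq_zero]
    linear_combination 2 * (u + v - δ / 2) * hsum - 8 * hprod - (v - u) ^ 2 * hw
  rcases horient with hD | hD
  · exact isStandardReduction_isoscelesQuartic hPs hu hv hδ hsum hcu huv hD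
      (by rw [hθ0, he₁]) (by rw [hθ1, he₁]) (by rw [hθ2, he₀])
  · have h2' : Equiv.swap (0 : Fin 3) 1 2 = 2 := by decide
    refine .of_comp (Equiv.swap 0 1) (isStandardReduction_isoscelesQuartic (c := c)
      (u := v) (v := u) (δ := δ) ?_ ?_ ?_ ?_ ?_ hcv huv.symm hD ?_ ?_ ?_)
    · simpa [h2'] using hPs
    · simpa using hv
    · simpa using hu
    · simpa [h2'] using hδ
    · rw [add_comm, hsum]
    · simp [hθ1, he₁]
    · simp [hθ0, he₁]
    · simp [h2', hθ2, he₀]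

theorem isStandard_isoscelesQuintic (h : IsPolynomialReduction d θ p e₀ e₁ P)
    (hp : ∀ i, p ≠ d i) (hroot : P.rootMultiplicity p ≠ 0) (h0 : P.rootMultiplicity (d 0) ≠ 0)
    (h1 : P.rootMultiplicity (d 1) ≠ 0) (h2 : P.rootMultiplicity (d 2) = 0) :
    IsStandardReduction d θ p P := by
  obtain ⟨κ, hκ, hid⟩ := h.exists_identity
  obtain ⟨h01, -, -⟩ := h.d_ne
  have hc := h.leadingCoeff_ne_zero
  have hP := h.eq_prod_of_triple_root hp hroot
  have he₀ := (h.triple_root hp hroot).2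
  obtain ⟨h0', hθ0⟩ := (h.simple_root (hp 0)).resolve_right (by simp [h0])
  obtain ⟨h1', hθ1⟩ := (h.simple_root (hp 1)).resolve_right (by simp [h1])
  have hθ2 : θ 2 = e₁ := ((h.simple_root (hp 2)).resolve_left (by simp [h2])).2
  simp only [h0', h1', h2, pow_zero, pow_one, mul_one] at hP
  set c := P.leadingCoeff
  have hP' : derivative P = C c * ((X - C p) ^ 2 * (3 * (X - C (d 0)) * (X - C (d 1)) +
      (X - C p) * (2 * X - C (d 0) - C (d 1)))) := by
    rw [hP]; simp only [derivative_C, derivative_mul, derivative_X_sub_C_pow, derivative_X_sub_C,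
      Nat.cast_ofNat, map_ofNat]; ring
  have hcan : C κ * C c * ((3 * (X - C (d 0)) * (X - C (d 1)) +
      (X - C p) * (2 * X - C (d 0) - C (d 1))) ^ 2 * (X - C (d 2))) = 1 - P := by
    refine mul_left_cancel₀ (a := C c * ((X - C p) ^ 4 * (X - C (d 0)) * (X - C (d 1))))
      (mul_ne_zero (C_ne_zero.mpr hc) (mul_ne_zero (mul_ne_zero
        (pow_ne_zero _ (X_sub_C_ne_zero _)) (X_sub_C_ne_zero _)) (X_sub_C_ne_zero _))) ?_
    rw [hP', Fin.prod_univ_three] at hid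
    linear_combination hid + (X - C p) * (1 - P) * hP
  obtain ⟨u, hu⟩ := exists_eq_add (d 0) p
  obtain ⟨v, hv⟩ := exists_eq_add (d 1) p
  obtain ⟨δ, hδ⟩ := exists_eq_add (d 2) p
  have hδ0 : δ ≠ 0 := fun h0 => hp 2 (by rw [hδ, h0, add_zero])
  have H : ∀ x, κ * c * ((5 * x ^ 2 - 4 * (u + v) * x + 3 * (u * v)) ^ 2 * (x - δ)) =
      1 - c * x ^ 3 * (x ^ 2 - (u + v) * x + u * v) := fun x => by
    have := congrArg (eval (x + p)) hcan
    rw [hP, hu, hv, hδ] at this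
    simp at this
    linear_combination this
  obtain ⟨-, -, -, c3, c4, c5, -⟩ := coeffs_eq_zero_of_sextic_eq_zero
    (a₀ := -(κ * c * (9 * (u * v) ^ 2 * δ)) - 1)
    (a₁ := κ * c * (9 * (u * v) ^ 2 + 24 * (u + v) * (u * v) * δ))
    (a₂ := -(κ * c * (24 * (u + v) * (u * v) + (16 * (u + v) ^ 2 + 30 * (u * v)) * δ)))
    (a₃ := κ * c * (16 * (u + v) ^ 2 + 30 * (u * v) + 40 * (u + v) * δ) + c * (u * v))
    (a₄ := -(κ * c * (40 * (u + v) + 25 * δ)) - c * (u + v)) (a₅ := 25 * κ * c + c)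
    (a₆ := 0) fun x => by linear_combination H x
  have hsum : u + v = -5 * δ / 3 := mul_left_cancel₀ hc (by
    linear_combination 5 / 3 * c4 + 5 / 3 * (40 * (u + v) + 25 * δ) / 25 * c5)
  have hprod : u * v = 40 * δ ^ 2 / 9 := mul_left_cancel₀ hc (by
    rw [hsum] at c3
    linear_combination -5 * c3 + (6 * (u * v) - 40 * δ ^ 2 / 9) * c5)
  have huv : u ≠ v := fun h => h01 (by rw [hu, hv, h])
  have hcδ : c * δ ^ 5 * 64 = 9 := by
    have := H δ
    rw [hsum, hprod] at this
    linear_combination 9 * this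
  have he₁ : e₁ = 1 / 2 := by
    -- After inserting `u + v` and `uv`, the remaining quadratic factor of `P'` is `5 (y² + 4δy/3 +
    -- 8δ²/3)`, with roots `δ (-2 ± √-20)/3`. One of them lying over `1` suffices.
    obtain ⟨w, hw⟩ := IsAlgClosed.exists_pow_nat_eq (-20 : ℂ) two_pos
    obtain ⟨y, hy⟩ : ∃ y : ℂ, y = δ * (w - 2) / 3 := ⟨_, rfl⟩
    have hy' : y ^ 2 + 4 / 3 * δ * y + 8 / 3 * δ ^ 2 = 0 := by
      rw [hy]; linear_combination δ ^ 2 / 9 * hw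
    have hδ2 : δ ^ 2 ≠ 0 := pow_ne_zero 2 hδ0
    have hy0 : y ≠ 0 := by
      intro h0; rw [h0] at hy'; exact hδ2 (by linear_combination 3 / 8 * hy')
    have hyδ : y ≠ δ := by
      intro h0; rw [h0] at hy'; exact hδ2 (by linear_combination 1 / 5 * hy')
    have hyuv : (y - u) * (y - v) ≠ 0 := by
      intro h0
      have h3 : δ * (y + 16 / 3 * δ) = 0 := by
        linear_combination 3 * (h0 - hy' + y * hsum - hprod)
      have h4 : y = -16 / 3 * δ := by
        linear_combination (mul_eq_zero.mp h3).resolve_left hδ0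
      rw [h4] at hy'
      exact hδ2 (by linear_combination 1 / 24 * hy')
    have : 2 * e₁ = 1 := by
      refine h.two_mul_eq_one_of_critical (x := p + y) (fun i => ?_)
        (fun hi => hy0 (by linear_combination hi))
        (rootMultiplicity_eq_zero fun hi => ?_) ?_
      · fin_cases i
        · change p + y ≠ d 0
          rw [hu]; intro hi; exact hyuv (by rw [add_left_cancel hi]; ring)
        · change p + y ≠ d 1
          rw [hv]; intro hi; exact hyuv (by rw [add_left_cancel hi]; ring)
        · change p + y ≠ d 2
          rw [hδ]; intro hi; exact hyδ (add_left_cancel hi)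
      · rw [IsRoot.def, hP, hu, hv] at hi
        simp only [eval_mul, eval_C, eval_pow, eval_sub, eval_X, add_sub_add_left_eq_sub,
          add_sub_cancel_left, mul_assoc] at hi
        exact mul_ne_zero hc (mul_ne_zero (pow_ne_zero 3 hy0) hyuv) hi
      · rw [hP', hu, hv]
        simp
        right; right
        linear_combination 5 * hy' - 4 * y * hsum + 3 * hprod
    linear_combination this / 2
  have hPs : ∀ s, P.eval s = c * ((s - p) ^ 3 * (s - d 0) * (s - d 1)) := fun s => by
    rw [hP]; simp
  have hw := Complex.I_mul_sqrt_sq (x := 15) (by norm_num)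
  push_cast at hw
  -- Here `(v - u)² = -15 δ²`.
  have horient : δ = Complex.I * (Real.sqrt 15 : ℂ) / 15 * (v - u) ∨
      δ = Complex.I * (Real.sqrt 15 : ℂ) / 15 * (u - v) := by
    rw [← sub_eq_zero, ← sub_eq_zero (b := _ * (u - v)), ← mul_eq_zero]
    linear_combination (u + v - 5 * δ / 3) / 15 * hsum - 4 / 15 * hprod - (v - u) ^ 2 / 225 * hw
  rcases horient with hD | hD
  · exact isStandardReduction_isoscelesQuintic hPs hu hv hδ hsum hcδ huv hD
      (by rw [hθ0, he₀]) (by rw [hθ1, he₀]) (by rw [hθ2, he₁])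
  · have h2' : Equiv.swap (0 : Fin 3) 1 2 = 2 := by decide
    refine .of_comp (Equiv.swap 0 1) (isStandardReduction_isoscelesQuintic (c := c)
      (u := v) (v := u) (δ := δ) (fun s => ?_) ?_ ?_ ?_ ?_ hcδ huv.symm hD ?_ ?_ ?_)
    · rw [hPs]; simp only [Function.comp_apply, Equiv.swap_apply_left, Equiv.swap_apply_right]; ring
    · simpa using hv
    · simpa using hu
    · simpa [h2'] using hδ
    · rw [add_comm, hsum]
    · simp [hθ1, he₀]
    · simp [hθ0, he₀]
    · simp [h2', hθ2, he₁]

theorem isStandard_equianharmonicSextic (h : IsPolynomialReduction d θ p e₀ e₁ P)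
    (hp : ∀ i, p ≠ d i) (hroot : P.rootMultiplicity p ≠ 0) (h0 : P.rootMultiplicity (d 0) ≠ 0)
    (h1 : P.rootMultiplicity (d 1) ≠ 0) (h2 : P.rootMultiplicity (d 2) ≠ 0) :
    IsStandardReduction d θ p P := by
  obtain ⟨κ, hκ, hid⟩ := h.exists_identity
  obtain ⟨h01, -, -⟩ := h.d_ne
  have hc := h.leadingCoeff_ne_zero
  have hP := h.eq_prod_of_triple_root hp hroot
  have he₀ := (h.triple_root hp hroot).2
  obtain ⟨h0', hθ0⟩ := (h.simple_root (hp 0)).resolve_right (by simp [h0])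
  obtain ⟨h1', hθ1⟩ := (h.simple_root (hp 1)).resolve_right (by simp [h1])
  obtain ⟨h2', hθ2⟩ := (h.simple_root (hp 2)).resolve_right (by simp [h2])
  simp only [h0', h1', h2', pow_one] at hP
  set c := P.leadingCoeff
  have hP' : derivative P = C c * ((X - C p) ^ 2 * (3 * (X - C (d 0)) * (X - C (d 1)) * (X - C (d 2))
      + (X - C p) * ((X - C (d 1)) * (X - C (d 2)) + (X - C (d 0)) * (X - C (d 2)) +
        (X - C (d 0)) * (X - C (d 1))))) := by
    rw [hP]; simp only [derivative_C, derivative_mul, derivative_X_sub_C_pow, derivative_X_sub_C,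
      Nat.cast_ofNat, map_ofNat]; ring
  have hcan : C κ * C c * (3 * (X - C (d 0)) * (X - C (d 1)) * (X - C (d 2))
      + (X - C p) * ((X - C (d 1)) * (X - C (d 2)) + (X - C (d 0)) * (X - C (d 2)) +
        (X - C (d 0)) * (X - C (d 1)))) ^ 2 = 1 - P := by
    refine mul_left_cancel₀
      (a := C c * ((X - C p) ^ 4 * (X - C (d 0)) * (X - C (d 1)) * (X - C (d 2))))
      (mul_ne_zero (C_ne_zero.mpr hc) (mul_ne_zero (mul_ne_zero (mul_ne_zero
        (pow_ne_zero _ (X_sub_C_ne_zero _)) (X_sub_C_ne_zero _)) (X_sub_C_ne_zero _))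
        (X_sub_C_ne_zero _))) ?_
    rw [hP', Fin.prod_univ_three] at hid
    linear_combination hid + (X - C p) * (1 - P) * hP
  obtain ⟨u, hu⟩ := exists_eq_add (d 0) p
  obtain ⟨v, hv⟩ := exists_eq_add (d 1) p
  obtain ⟨r, hr⟩ := exists_eq_add (d 2) p
  -- The identity is symmetric in the `d i`. Its coefficients force `S = T = 0`, so `u, v, r` are
  -- the cube roots of `U`.
  obtain ⟨S, hS⟩ : ∃ S, S = u + v + r := ⟨_, rfl⟩
  obtain ⟨T, hT⟩ : ∃ T, T = u * v + u * r + v * r := ⟨_, rfl⟩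
  obtain ⟨U, hU⟩ : ∃ U, U = u * v * r := ⟨_, rfl⟩
  have H : ∀ x, κ * c * (6 * x ^ 3 - 5 * S * x ^ 2 + 4 * T * x - 3 * U) ^ 2 =
      1 - c * x ^ 3 * (x ^ 3 - S * x ^ 2 + T * x - U) := fun x => by
    have := congrArg (eval (x + p)) hcan
    rw [hP, hu, hv, hr] at this
    simp at this
    rw [hS, hT, hU]
    linear_combination this
  obtain ⟨c0, -, -, -, c4, c5, c6⟩ := coeffs_eq_zero_of_sextic_eq_zero
    (a₀ := κ * c * (9 * U ^ 2) - 1)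
    (a₁ := -(κ * c * (24 * T * U)))
    (a₂ := κ * c * (16 * T ^ 2 + 30 * S * U))
    (a₃ := -(κ * c * (40 * S * T + 36 * U)) - c * U)
    (a₄ := κ * c * (25 * S ^ 2 + 48 * T) + c * T)
    (a₅ := -(κ * c * 60 * S) - c * S) (a₆ := 36 * κ * c + c)
    fun x => by linear_combination H x
  have hS0 : S = 0 := mul_left_cancel₀ hc (by
    linear_combination 3 / 2 * c5 + 5 / 2 * S * c6)
  have hT0 : T = 0 := mul_left_cancel₀ hc (by
    rw [hS0] at c4
    linear_combination -3 * c4 + 4 * T * c6)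
  have hr' : r = -(u + v) := by linear_combination hS0 - hS
  have hq : u ^ 2 + u * v + v ^ 2 = 0 := by
    rw [hr'] at hT; linear_combination hT - hT0
  have hUu : U = u ^ 3 := by rw [hU, hr']; linear_combination -u * hq
  have hUv : U = v ^ 3 := by rw [hU, hr']; linear_combination -v * hq
  have hcU : c * U ^ 2 = -4 := by linear_combination U ^ 2 * c6 - 4 * c0
  have huv : u ≠ v := fun h => h01 (by rw [hu, hv, h])
  have hPs : ∀ s, P.eval s = c * ((s - p) ^ 3 * ((s - p) ^ 3 - U)) := fun s => by
    rw [hP, hu, hv, hr]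
    simp
    left
    linear_combination (s - p) ^ 5 * (hS - hS0) - (s - p) ^ 4 * (hT - hT0) + (s - p) ^ 3 * hU
  have hw := Complex.I_mul_sqrt_sq (x := 3) (by norm_num)
  push_cast at hw
  rcases equilateral_orientation hw hq with hD | hD
  · rw [hUu] at hPs hcU
    exact isStandardReduction_equianharmonicSextic hPs hu hv (by rw [hr, hr']; ring) huv
      (by linear_combination hcU) hD (by rw [hθ0, he₀]) (by rw [hθ1, he₀]) (by rw [hθ2, he₀])
  · rw [hUv] at hPs hcU
    refine .of_comp (Equiv.swap 0 1) (isStandardReduction_equianharmonicSextic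
      (u := v) (v := u) hPs ?_ ?_ ?_ huv.symm (by linear_combination hcU) hD ?_ ?_ ?_)
    · simpa using hv
    · simpa using hu
    · rw [Function.comp_apply, Equiv.swap_apply_of_ne_of_ne (by decide) (by decide), hr, hr']; ring
    · simp [hθ1, he₀]
    · simp [hθ0, he₀]
    · simp [hθ2, he₀, Equiv.swap_apply_of_ne_of_ne]

/-- Each `d j ≠ p` is a simple root of `P` or of `1 - P`. The number of those over `0` ranges over
`0, 1, 2` if `p` is a `d i` and over `0, 1, 2, 3` otherwise; permutations reduce each count to one
pattern. -/
theorem isStandardReduction_of_root (h : IsPolynomialReduction d θ p e₀ e₁ P)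
    (hroot : P.rootMultiplicity p ≠ 0) : IsStandardReduction d θ p P := by
  by_cases hp : ∃ i, p = d i
  · obtain ⟨i, hi⟩ := hp
    wlog hi1 : i = 1 generalizing i d θ
    · refine .of_comp (Equiv.swap 1 i) (this (h.comp _) 1 ?_ rfl)
      simpa using hi
    subst hi1
    by_cases h0 : P.rootMultiplicity (d 0) = 0 <;> by_cases h2 : P.rootMultiplicity (d 2) = 0
    · exact h.isStandard_harmonicQuadratic hi hroot h0 h2
    · exact h.isStandard_collinearCubic hi hroot h0 h2
    · exact .of_comp (Equiv.swap 0 2) ((h.comp _).isStandard_collinearCubic hi hroot h2 h0)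
    · exact h.isStandard_harmonicQuartic hi hroot h0 h2
  · push Not at hp
    have hp' := fun (τ : Equiv.Perm (Fin 3)) i => hp (τ i)
    by_cases h0 : P.rootMultiplicity (d 0) = 0 <;> by_cases h1 : P.rootMultiplicity (d 1) = 0 <;>
      by_cases h2 : P.rootMultiplicity (d 2) = 0
    · exact h.isStandard_equianharmonicCubic hp hroot h0 h1 h2
    · exact h.isStandard_isoscelesQuartic hp hroot h0 h1 h2
    · exact .of_comp (Equiv.swap 1 2)
        ((h.comp _).isStandard_isoscelesQuartic (hp' _) hroot h0 h2 h1)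
    · exact .of_comp (Equiv.swap 0 2)
        ((h.comp _).isStandard_isoscelesQuintic (hp' _) hroot h2 h1 h0)
    · exact .of_comp (Equiv.swap 0 2)
        ((h.comp _).isStandard_isoscelesQuartic (hp' _) hroot h2 h1 h0)
    · exact .of_comp (Equiv.swap 1 2)
        ((h.comp _).isStandard_isoscelesQuintic (hp' _) hroot h0 h2 h1)
    · exact h.isStandard_isoscelesQuintic hp hroot h0 h1 h2
    · exact h.isStandard_equianharmonicSextic hp hroot h0 h1 h2

theorem isStandardReduction (h : IsPolynomialReduction d θ p e₀ e₁ P) :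
    IsStandardReduction d θ p P := by
  rcases h.root_or_one_sub_root with hroot | hroot
  · exact h.isStandardReduction_of_root hroot
  · exact (h.swap.isStandardReduction_of_root hroot).one_sub

end IsPolynomialReduction

/-! ### The converse: from a polynomial identity to a reduction. -/

/-- The polynomial substitution `P` pulls back the hypergeometric equation with exponent parameters
`e₀`, `e₁` at `0`, `1` to the equation with singular points `d i`, exponent parameters `θ i` and
normalized accessory parameter `p`: equality of the coefficients as functions. -/
structure IsReductionIdentity (d θ : Fin 3 → ℂ) (p e₀ e₁ : ℂ) (P : ℂ[X]) : Prop where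
  derivative_ne_zero : derivative P ≠ 0
  exists_identity : ∃ κ : ℂ, κ ≠ 0 ∧ ∀ s,
    κ * (derivative P).eval s ^ 2 * ∏ i, (s - d i) = (s - p) * P.eval s * (1 - P.eval s)
  first_coefficient : ∀ᶠ s in cofinite, e₀ * ((derivative P).eval s / P.eval s) +
    e₁ * ((derivative P).eval s / (P.eval s - 1)) -
      (derivative (derivative P)).eval s / (derivative P).eval s = ∑ i, θ i / (s - d i)

namespace IsReductionIdentity

variable {d θ : Fin 3 → ℂ} {p e₀ e₁ : ℂ} {P : ℂ[X]}

theorem swap (h : IsReductionIdentity d θ p e₀ e₁ P) :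
    IsReductionIdentity d θ p e₁ e₀ (1 - P) := by
  obtain ⟨κ, hκ, hid⟩ := h.exists_identity
  refine ⟨by simpa using h.derivative_ne_zero, ⟨κ, hκ, fun s => ?_⟩, ?_⟩
  · simp only [derivative_sub, derivative_one, zero_sub, eval_neg, eval_sub, eval_one]
    linear_combination hid s
  · filter_upwards [h.first_coefficient] with s hs
    rw [← hs]
    simp only [derivative_sub, derivative_one, zero_sub, derivative_neg, eval_neg, eval_sub,
      eval_one, neg_div_neg_eq]
    rw [show 1 - P.eval s = -(P.eval s - 1) by ring, neg_div_neg_eq,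
      show -(P.eval s - 1) - 1 = -P.eval s by ring, neg_div_neg_eq]
    ring

theorem of_comp (σ : Equiv.Perm (Fin 3)) (h : IsReductionIdentity (d ∘ σ) (θ ∘ σ) p e₀ e₁ P) :
    IsReductionIdentity d θ p e₀ e₁ P := by
  obtain ⟨κ, hκ, hid⟩ := h.exists_identity
  refine ⟨h.derivative_ne_zero, ⟨κ, hκ, fun s => ?_⟩, ?_⟩
  · rw [← hid s]
    simp only [Function.comp_apply]
    rw [Equiv.prod_comp σ fun i => s - d i]
  · filter_upwards [h.first_coefficient] with s hs
    rw [hs]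
    exact Equiv.sum_comp σ fun i => θ i / (s - d i)

/-- Composition with an affine map. -/
theorem comp_affine {m n : ℂ} (hm : m ≠ 0)
    (h : IsReductionIdentity (fun i => m * d i + n) θ (m * p + n) e₀ e₁ P) :
    IsReductionIdentity d θ p e₀ e₁ (P.comp (C m * X + C n)) := by
  obtain ⟨κ, hκ, hid⟩ := h.exists_identity
  have hder : derivative (P.comp (C m * X + C n)) =
      C m * (derivative P).comp (C m * X + C n) := by
    rw [derivative_comp]; simp
  have hinj : Function.Injective fun s => m * s + n := fun a b hab =>
    mul_left_cancel₀ hm (add_right_cancel hab)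
  refine ⟨?_, ⟨κ, hκ, fun s => ?_⟩, ?_⟩
  · rw [hder]
    refine mul_ne_zero (C_ne_zero.mpr hm) fun h0 => h.derivative_ne_zero ?_
    refine Polynomial.funext fun t => ?_
    have := congrArg (eval ((t - n) / m)) h0
    simpa [mul_div_cancel₀ _ hm] using this
  · have := hid (m * s + n)
    simp only [Fin.prod_univ_three] at this ⊢
    simp only [hder, eval_mul, eval_comp, eval_add, eval_C, eval_X]
    refine mul_left_cancel₀ hm ?_
    linear_combination this
  · filter_upwards [hinj.tendsto_cofinite.eventually h.first_coefficient] with s hs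
    simp only [hder, derivative_comp, eval_mul, eval_comp, eval_add, eval_C,
      eval_X, derivative_add, derivative_mul, derivative_C, derivative_X, zero_mul, mul_one,
      zero_add, add_zero]
    rw [mul_div_mul_left _ _ hm, mul_div_assoc, mul_div_assoc, mul_div_assoc]
    rw [show ∑ i, θ i / (s - d i) = m * ∑ i, θ i / (m * s + n - (m * d i + n)) by
      rw [Finset.mul_sum]
      refine Finset.sum_congr rfl fun i _ => ?_
      rw [add_sub_add_right_eq_sub, ← mul_sub, mul_div_assoc', mul_div_mul_left _ _ hm], ← hs]
    ring

/-- The logarithmic derivative of the identity between the coefficients of `u` determines the term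
`P'' / P'` in the coefficient of `u'`. -/
theorem of_logDeriv {κ : ℂ} (hκ : κ ≠ 0) (hP' : derivative P ≠ 0)
    (hid : ∀ s, κ * (derivative P).eval s ^ 2 * ((s - d 0) * (s - d 1) * (s - d 2)) =
      (s - p) * P.eval s * (1 - P.eval s))
    (hlog : ∀ s, P.eval s ≠ 0 → P.eval s - 1 ≠ 0 → s - p ≠ 0 → s - d 0 ≠ 0 → s - d 1 ≠ 0 →
      s - d 2 ≠ 0 →
      (2 * e₀ - 1) * ((derivative P).eval s / P.eval s) +
        (2 * e₁ - 1) * ((derivative P).eval s / (P.eval s - 1)) =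
        1 / (s - p) + ((2 * θ 0 - 1) / (s - d 0) + (2 * θ 1 - 1) / (s - d 1) +
          (2 * θ 2 - 1) / (s - d 2))) :
    IsReductionIdentity d θ p e₀ e₁ P := by
  refine ⟨hP', ⟨κ, hκ, by simpa only [Fin.prod_univ_three] using hid⟩, ?_⟩
  have hP0 : P ≠ 0 := by rintro rfl; simp at hP'
  have hP1 : P - 1 ≠ 0 := by intro h0; rw [sub_eq_zero.mp h0] at hP'; simp at hP'
  have hpoly : C κ * derivative P ^ 2 * ((X - C (d 0)) * (X - C (d 1)) * (X - C (d 2))) =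
      (X - C p) * P * (1 - P) := Polynomial.funext fun s => by simpa using hid s
  have hpoly' := congrArg derivative hpoly
  filter_upwards [eventually_cofinite_eval_ne_zero hP0, eventually_cofinite_eval_ne_zero hP1,
    eventually_cofinite_eval_ne_zero hP', eventually_cofinite_eval_ne_zero (X_sub_C_ne_zero p),
    eventually_cofinite_eval_ne_zero (X_sub_C_ne_zero (d 0)),
    eventually_cofinite_eval_ne_zero (X_sub_C_ne_zero (d 1)),
    eventually_cofinite_eval_ne_zero (X_sub_C_ne_zero (d 2))] with s h0 h1 h2 h3 h4 h5 h6
  simp only [eval_sub, eval_X, eval_C, eval_one] at h1 h3 h4 h5 h6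
  have hlog' := hlog s h0 h1 h3 h4 h5 h6
  have h7 := hid s
  have h8 := congrArg (eval s) hpoly'
  simp only [derivative_mul, derivative_C, derivative_sub, derivative_X, derivative_one,
    derivative_pow, eval_mul, eval_add, eval_sub, eval_X, eval_C, eval_pow, eval_one, eval_zero,
    Nat.cast_ofNat, map_ofNat, eval_ofNat, Nat.add_one_sub_one, pow_one] at h8
  rw [Fin.sum_univ_three]
  generalize eval s (derivative (derivative P)) = f'' at *
  generalize eval s (derivative P) = f' at *
  generalize eval s P = f at *
  -- This is the derivative of the identity divided by the identity; `hL` and `hR` clear the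
  -- denominators.
  have hkey : 2 * (f'' / f') + (1 / (s - d 0) + 1 / (s - d 1) + 1 / (s - d 2)) =
      1 / (s - p) + f' / f + f' / (f - 1) := by
    have h9 : κ * f' ^ 2 * ((s - d 0) * (s - d 1) * (s - d 2)) ≠ 0 := by
      simp [hκ, h2, h4, h5, h6]
    have hL : (κ * f' ^ 2 * ((s - d 0) * (s - d 1) * (s - d 2))) *
        (2 * (f'' / f') + (1 / (s - d 0) + 1 / (s - d 1) + 1 / (s - d 2))) =
        κ * (2 * f' * f'') * ((s - d 0) * (s - d 1) * (s - d 2)) + κ * f' ^ 2 *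
          ((s - d 1) * (s - d 2) + (s - d 0) * (s - d 2) + (s - d 0) * (s - d 1)) := by
      field_simp
    have hR : ((s - p) * f * (1 - f)) * (1 / (s - p) + f' / f + f' / (f - 1)) =
        f * (1 - f) + (s - p) * f' * (1 - f) - (s - p) * f * f' := by
      field_simp
      ring
    refine mul_left_cancel₀ h9 ?_
    rw [hL, h7, hR]
    linear_combination h8
  linear_combination 1 / 2 * hlog' - 1 / 2 * hkey

theorem reducesToHypergeometric {d₁ d₂ d₃ α β γ δ ε : ℂ}
    (h : IsReductionIdentity ![d₁, d₂, d₃] ![γ, δ, ε] p e₀ e₁ P) :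
    ∃ a b c, ReducesToHypergeometric (generalHeunODE d₁ d₂ d₃ α β γ δ ε (α * β * p))
      (algebraMap ℂ[X] (RatFunc ℂ) P) a b c := by
  obtain ⟨κ, hκ, hid⟩ := h.exists_identity
  -- The parameters must satisfy `a + b = e₀ + e₁ - 1` and `ab = -κ αβ`; `r²` is the discriminant of
  -- the resulting quadratic.
  obtain ⟨r, hr⟩ := IsAlgClosed.exists_pow_nat_eq ((e₀ + e₁ - 1) ^ 2 + 4 * (κ * (α * β))) two_pos
  have hP0 : P ≠ 0 := by rintro rfl; simpa using h.derivative_ne_zero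
  have hP1 : P - 1 ≠ 0 := by
    intro h0; have := h.derivative_ne_zero; rw [sub_eq_zero.mp h0] at this; simp at this
  refine ⟨(e₀ + e₁ - 1 + r) / 2, (e₀ + e₁ - 1 - r) / 2, e₀, fun k hk => ?_, ?_, ?_⟩
  · rw [← RatFunc.algebraMap_C] at hk
    have := RatFunc.algebraMap_injective ℂ hk
    have h0 := h.derivative_ne_zero
    rw [this] at h0
    simp at h0
  · filter_upwards [h.first_coefficient] with s hs
    simp only [LinearODE2.pullback, hypergeometricODE, generalHeunODE, RatFunc.eval_algebraMap,
      Algebra.algebraMap_self, RingHom.id_apply, eval₂_id, deriv_eval_polynomial]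
    simp only [Fin.sum_univ_three, Matrix.cons_val] at hs
    rw [← hs]
    ring
  · filter_upwards [eventually_cofinite_eval_ne_zero hP0, eventually_cofinite_eval_ne_zero hP1,
      eventually_cofinite_eval_ne_zero (X_sub_C_ne_zero d₁),
      eventually_cofinite_eval_ne_zero (X_sub_C_ne_zero d₂),
      eventually_cofinite_eval_ne_zero (X_sub_C_ne_zero d₃)] with s h0 h1 h2 h3 h4
    simp only [eval_sub, eval_X, eval_C, eval_one] at h1 h2 h3 h4
    have hs := hid s
    simp only [LinearODE2.pullback, hypergeometricODE, generalHeunODE, RatFunc.eval_algebraMap,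
      Algebra.algebraMap_self, RingHom.id_apply, eval₂_id, deriv_eval_polynomial]
    simp only [Fin.prod_univ_three, Matrix.cons_val] at hs
    rw [show (e₀ + e₁ - 1 + r) / 2 * ((e₀ + e₁ - 1 - r) / 2) = -(κ * (α * β)) by
      linear_combination -1 / 4 * hr]
    rw [div_mul_eq_mul_div, div_eq_div_iff (mul_ne_zero h0 h1)
      (mul_ne_zero (mul_ne_zero h2 h3) h4)]
    linear_combination -(α * β) * hs

end IsReductionIdentity

/-! ### The identities on the seven model triangles. -/

namespace ReductionType

variable {θ : Fin 3 → ℂ}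

theorem derivative_ne_zero_of_eval {P : ℂ[X]} {t : ℂ} (h : (derivative P).eval t ≠ 0) :
    derivative P ≠ 0 := fun h0 => h (by rw [h0, eval_zero])

theorem isReductionIdentity_harmonicQuadratic (h : θ 0 = θ 2) :
    IsReductionIdentity ![0, 1, 2] θ 1 (θ 0) ((1 + θ 1) / 2) harmonicQuadratic.R₁ := by
  have hT : ∀ t, harmonicQuadratic.R₁.eval t = t * (2 - t) := fun t => by simp [R₁]
  have hT' : ∀ t, (derivative harmonicQuadratic.R₁).eval t = 2 * (1 - t) := fun t => by
    simp [R₁]; ring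
  -- Comparing leading coefficients gives `κ = -1/n²` for a substitution of degree `n`, here and in
  -- the other cases.
  refine .of_logDeriv (κ := -1 / 4) (by norm_num)
    (derivative_ne_zero_of_eval (t := 0) (by simp [hT'])) (fun t => ?_)
    fun t h0 h1 hp hd0 hd1 hd2 => ?_
  · rw [hT, hT']; simp; ring
  · rw [hT] at *
    rw [hT', ← h]
    simp only [Matrix.cons_val, sub_zero] at *
    rw [show t * (2 - t) - 1 = -(t - 1) ^ 2 by ring]
    rw [show t * (2 - t) = -(t * (t - 2)) by ring]
    field_simp
    ring

theorem isReductionIdentity_collinearCubic (hθ1 : 1 - θ 1 = 2 * (1 - θ 2)) (hθ0 : θ 0 = 1 / 2) :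
    IsReductionIdentity ![0, 1, 4] θ 1 (θ 2) (1 / 2) collinearCubic.R₁ := by
  have hT : ∀ t, collinearCubic.R₁.eval t = (t - 1) ^ 2 * (1 - 1 / 4 * t) := fun t => by simp [R₁]
  have hT' : ∀ t, (derivative collinearCubic.R₁).eval t = (t - 1) * (-3 / 4) * (t - 3) := fun t => by
    simp [R₁, derivative_pow]; ring
  refine .of_logDeriv (κ := -1 / 9) (by norm_num)
    (derivative_ne_zero_of_eval (t := 0) (by norm_num [hT'])) (fun t => ?_)
    fun t h0 h1 hp hd0 hd1 hd2 => ?_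
  · rw [hT, hT']; simp; ring
  · rw [hT] at *
    rw [hT', show θ 1 = 2 * θ 2 - 1 by linear_combination -hθ1, hθ0]
    simp only [Matrix.cons_val, sub_zero] at *
    rw [show (t - 1) ^ 2 * (1 - 1 / 4 * t) = -((t - 1) ^ 2 * (t - 4)) / 4 by ring]
    field_simp
    ring

theorem isReductionIdentity_harmonicQuartic (hθ0 : θ 0 = θ 2) (hθ1 : 1 - θ 1 = 2 * (1 - θ 0)) :
    IsReductionIdentity ![0, 1, 2] θ 1 (1 / 2) (θ 0) harmonicQuartic.R₁ := by
  have hT : ∀ t, harmonicQuartic.R₁.eval t = 4 * (t * (2 - t) - 1 / 2) ^ 2 := fun t => by simp [R₁]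
  have hT' : ∀ t, (derivative harmonicQuartic.R₁).eval t =
      16 * (t * (2 - t) - 1 / 2) * (1 - t) := fun t => by
    simp [R₁, derivative_pow]; ring
  refine .of_logDeriv (κ := -1 / 16) (by norm_num)
    (derivative_ne_zero_of_eval (t := 0) (by norm_num [hT'])) (fun t => ?_)
    fun t h0 h1 hp hd0 hd1 hd2 => ?_
  · rw [hT, hT']; simp; ring
  · rw [hT] at *
    rw [hT', show θ 1 = 2 * θ 0 - 1 by linear_combination -hθ1, ← hθ0]
    simp only [Matrix.cons_val, sub_zero] at *
    rw [show 2 * (1 / 2 : ℂ) - 1 = 0 by norm_num, zero_mul, zero_add,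
      show 4 * (t * (2 - t) - 1 / 2) ^ 2 - 1 = 4 * t * (t - 2) * (t - 1) ^ 2 by ring]
    field_simp
    ring

theorem isReductionIdentity_equianharmonicCubic (hθ0 : θ 0 = θ 1) (hθ1 : θ 1 = θ 2) :
    IsReductionIdentity ![0, 1, equianharmonicCubic.D] θ equianharmonicCubic.p₀ (2 / 3) (θ 0)
      equianharmonicCubic.R₁ := by
  have hw := Complex.I_mul_sqrt_sq (x := 3) (by norm_num)
  push_cast at hw
  -- Only `w² = -3` matters from here on, so all constants are written in terms of an opaque `w`.
  obtain ⟨w, hw'⟩ : ∃ w, w = Complex.I * (Real.sqrt 3 : ℂ) := ⟨_, rfl⟩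
  rw [← hw'] at hw
  have hw0 : w ≠ 0 := by rintro rfl; norm_num at hw
  have hp : equianharmonicCubic.p₀ = 1 / 2 + w / 6 := by rw [hw']; rfl
  have hD : equianharmonicCubic.D = 1 / 2 + w / 2 := by rw [hw']; rfl
  have hpinv : equianharmonicCubic.p₀⁻¹ = 3 * (1 / 2 - w / 6) :=
    inv_eq_of_mul_eq_one_right (by rw [hp]; linear_combination -1 / 12 * hw)
  have hT : equianharmonicCubic.R₁ = C (3 * w) * (X - C (1 / 2 + w / 6)) ^ 3 :=
    Polynomial.funext fun t => by
      simp only [R₁, hpinv, eval_mul, eval_sub, eval_pow, eval_one, eval_C, eval_X]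
      grind
  have hT1 : ∀ t, 3 * w * (t - (1 / 2 + w / 6)) ^ 3 - 1 =
      3 * w * (t * (t - 1) * (t - (1 / 2 + w / 2))) := fun t => by grind
  have hT' : ∀ t, (derivative equianharmonicCubic.R₁).eval t =
      9 * w * (t - (1 / 2 + w / 6)) ^ 2 := fun t => by
    rw [hT]
    simp only [derivative_C, derivative_mul, derivative_X_sub_C_pow,
      Nat.cast_ofNat, map_ofNat, eval_add, eval_mul, eval_sub, eval_pow, eval_X,
      eval_C, eval_zero, eval_ofNat]
    ring
  replace hT : ∀ t, equianharmonicCubic.R₁.eval t = 3 * w * (t - (1 / 2 + w / 6)) ^ 3 := fun t => by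
    rw [hT]; simp
  rw [hp, hD]
  refine .of_logDeriv (κ := -1 / 9) (by norm_num)
    (derivative_ne_zero_of_eval (t := 3 / 2 + w / 6) (by rw [hT']; ring_nf; simpa using hw0))
    (fun t => ?_) fun t h0 h1 hp hd0 hd1 hd2 => ?_
  · rw [← neg_sub _ (1 : ℂ), hT, hT1, hT']; simp; ring
  · rw [hT] at *
    rw [hT', ← hθ1, ← hθ0]
    simp only [Matrix.cons_val, sub_zero] at *
    -- Since `t (t - 1) (t - D)` and `(t - p₀)³` differ by a constant, their derivatives agree.
    have hd : (t - 1) * (t - (1 / 2 + w / 2)) + t * (t - (1 / 2 + w / 2)) + t * (t - 1) =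
      3 * (t - (1 / 2 + w / 6)) ^ 2 := by grind
    have e1 : 9 * w * (t - (1 / 2 + w / 6)) ^ 2 / (3 * w * (t - (1 / 2 + w / 6)) ^ 3) =
      3 / (t - (1 / 2 + w / 6)) := by field_simp; norm_num
    have e2 : 9 * w * (t - (1 / 2 + w / 6)) ^ 2 /
        (3 * w * (t * (t - 1) * (t - (1 / 2 + w / 2)))) =
          1 / t + 1 / (t - 1) + 1 / (t - (1 / 2 + w / 2)) := by
      generalize t - (1 / 2 + w / 2) = y at *
      generalize t - (1 / 2 + w / 6) = z at *
      field_simp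
      linear_combination -3 * hd
    rw [hT1, e1, e2]
    ring

theorem isReductionIdentity_isoscelesQuartic (hθ0 : θ 0 = 1 / 2) (hθ1 : θ 1 = 1 / 2)
    (hθ2 : θ 2 = 2 / 3) :
    IsReductionIdentity ![0, 1, isoscelesQuartic.D] θ isoscelesQuartic.p₀ (2 / 3) (1 / 2)
      isoscelesQuartic.R₁ := by
  have hw := Complex.I_mul_sqrt_sq (x := 2) (by norm_num)
  push_cast at hw
  obtain ⟨w, hw'⟩ : ∃ w, w = Complex.I * (Real.sqrt 2 : ℂ) := ⟨_, rfl⟩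
  rw [← hw'] at hw
  have hw0 : w ≠ 0 := by rintro rfl; norm_num at hw
  have hp : isoscelesQuartic.p₀ = 1 / 2 + w / 4 := by rw [hw']; rfl
  have hD : isoscelesQuartic.D = 1 / 2 + 5 * w / 4 := by rw [hw', D]; ring
  have hpinv : isoscelesQuartic.p₀⁻¹ = 8 / 3 * (1 / 2 - w / 4) :=
    inv_eq_of_mul_eq_one_right (by rw [hp]; linear_combination -1 / 6 * hw)
  have hDinv : isoscelesQuartic.D⁻¹ = 8 / 27 * (1 / 2 - 5 * w / 4) :=
    inv_eq_of_mul_eq_one_right (by rw [hD]; linear_combination -25 / 54 * hw)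
  have hT : isoscelesQuartic.R₁ =
      C (-64 / 27) * ((X - C (1 / 2 + w / 4)) ^ 3 * (X - C (1 / 2 + 5 * w / 4))) :=
    Polynomial.funext fun t => by
      simp only [R₁, hpinv, hDinv, eval_mul, eval_sub, eval_pow, eval_one, eval_C, eval_X]
      grind
  -- The double root `1/2 + w` of `1 - R₁` is the critical point of `R₁` other than `p₀`.
  have hT1 : ∀ t, 1 - -64 / 27 * ((t - (1 / 2 + w / 4)) ^ 3 * (t - (1 / 2 + 5 * w / 4))) =
      64 / 27 * (t * (t - 1) * (t - (1 / 2 + w)) ^ 2) := fun t => by grind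
  have hT' : ∀ t, (derivative isoscelesQuartic.R₁).eval t =
      -256 / 27 * ((t - (1 / 2 + w / 4)) ^ 2 * (t - (1 / 2 + w))) := fun t => by
    rw [hT]
    simp only [derivative_C, derivative_mul, derivative_X_sub_C_pow, derivative_X_sub_C,
      Nat.cast_ofNat, map_ofNat, eval_add, eval_mul, eval_sub, eval_pow, eval_X,
      eval_C, eval_zero, eval_one, eval_ofNat]
    ring
  replace hT : ∀ t, isoscelesQuartic.R₁.eval t =
      -64 / 27 * ((t - (1 / 2 + w / 4)) ^ 3 * (t - (1 / 2 + 5 * w / 4))) := fun t => by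
    rw [hT]; simp
  rw [hp, hD]
  refine .of_logDeriv (κ := -1 / 16) (by norm_num)
    (derivative_ne_zero_of_eval (t := 1 / 2) (by rw [hT']; ring_nf; simpa using hw0))
    (fun t => ?_) fun t h0 h1 hp hd0 hd1 hd2 => ?_
  · rw [hT, hT1, hT']; simp; ring
  · rw [hT] at *
    rw [hT', hθ0, hθ1, hθ2]
    simp only [Matrix.cons_val, sub_zero] at *
    have e : t - (1 / 2 + w) = 1 / 4 * (3 * (t - (1 / 2 + 5 * w / 4)) + (t - (1 / 2 + w / 4))) := by
      ring
    rw [e]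
    generalize t - (1 / 2 + 5 * w / 4) = y at *
    generalize t - (1 / 2 + w / 4) = z at *
    field_simp
    ring

theorem isReductionIdentity_isoscelesQuintic (hθ0 : θ 0 = 2 / 3) (hθ1 : θ 1 = 2 / 3)
    (hθ2 : θ 2 = 1 / 2) :
    IsReductionIdentity ![0, 1, isoscelesQuintic.D] θ isoscelesQuintic.p₀ (2 / 3) (1 / 2)
      isoscelesQuintic.R₁ := by
  have hw := Complex.I_mul_sqrt_sq (x := 15) (by norm_num)
  push_cast at hw
  obtain ⟨w, hw'⟩ : ∃ w, w = Complex.I * (Real.sqrt 15 : ℂ) := ⟨_, rfl⟩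
  rw [← hw'] at hw
  have hw0 : w ≠ 0 := by rintro rfl; norm_num at hw
  have hp : isoscelesQuintic.p₀ = 1 / 2 + w / 18 := by rw [hw']; rfl
  have hD : isoscelesQuintic.D = 1 / 2 + 11 * w / 90 := by rw [hw', D]; ring
  have hc : -Complex.I * (2025 * (Real.sqrt 15 : ℂ)) / 64 = -2025 / 64 * w := by rw [hw']; ring
  have hT : isoscelesQuintic.R₁ =
      C (-2025 / 64 * w) * (X * (X - C 1) * (X - C (1 / 2 + w / 18)) ^ 3) := by
    rw [R₁, hc, hp, C_1]
  have hT1 : ∀ t, 1 - -2025 / 64 * w * (t * (t - 1) * (t - (1 / 2 + w / 18)) ^ 3) =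
      2025 / 64 * w * ((t - (1 / 2 + 11 * w / 90)) * ((t - (1 / 2 + w / 18)) ^ 2 +
        4 * w / 45 * (t - (1 / 2 + w / 18)) - 8 / 45) ^ 2) := fun t => by grind
  have hQ : ∀ t, 5 * ((t - (1 / 2 + w / 18)) ^ 2 + 4 * w / 45 * (t - (1 / 2 + w / 18)) - 8 / 45) =
      (2 * t - 1) * (t - (1 / 2 + w / 18)) + 3 * (t * (t - 1)) := fun t => by grind
  have hT' : ∀ t, (derivative isoscelesQuintic.R₁).eval t =
      -2025 / 64 * w * ((t - (1 / 2 + w / 18)) ^ 2 *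
        ((2 * t - 1) * (t - (1 / 2 + w / 18)) + 3 * (t * (t - 1)))) := fun t => by
    rw [hT]
    simp only [derivative_C, derivative_mul, derivative_X_sub_C_pow, derivative_X_sub_C,
      derivative_X, Nat.cast_ofNat, map_ofNat, eval_add, eval_mul, eval_sub, eval_pow, eval_X,
      eval_C, eval_zero, eval_one, eval_ofNat]
    ring
  replace hT : ∀ t, isoscelesQuintic.R₁.eval t =
      -2025 / 64 * w * (t * (t - 1) * (t - (1 / 2 + w / 18)) ^ 3) := fun t => by
    rw [hT]; simp
  rw [hp, hD]
  refine .of_logDeriv (κ := -1 / 25) (by norm_num)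
    (derivative_ne_zero_of_eval (t := 1 / 2) (by rw [hT']; ring_nf; simpa using hw0))
    (fun t => ?_) fun t h0 h1 hp hd0 hd1 hd2 => ?_
  · rw [hT, hT1, hT', ← hQ]; simp; ring
  · rw [hT] at *
    rw [hT', hθ0, hθ1, hθ2]
    simp only [Matrix.cons_val, sub_zero] at *
    generalize t - (1 / 2 + w / 18) = z at *
    field_simp
    ring

theorem isReductionIdentity_equianharmonicSextic (hθ0 : θ 0 = 2 / 3) (hθ1 : θ 1 = 2 / 3)
    (hθ2 : θ 2 = 2 / 3) :
    IsReductionIdentity ![0, 1, equianharmonicSextic.D] θ equianharmonicSextic.p₀ (1 / 2) (2 / 3)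
      equianharmonicSextic.R₁ := by
  have hw := Complex.I_mul_sqrt_sq (x := 3) (by norm_num)
  push_cast at hw
  obtain ⟨w, hw'⟩ : ∃ w, w = Complex.I * (Real.sqrt 3 : ℂ) := ⟨_, rfl⟩
  rw [← hw'] at hw
  have hw0 : w ≠ 0 := by rintro rfl; norm_num at hw
  have hp : equianharmonicSextic.p₀ = 1 / 2 + w / 6 := by rw [hw']; rfl
  have hD : equianharmonicSextic.D = 1 / 2 + w / 2 := by rw [hw']; rfl
  have hpinv : equianharmonicSextic.p₀⁻¹ = 3 * (1 / 2 - w / 6) :=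
    inv_eq_of_mul_eq_one_right (by rw [hp]; linear_combination -1 / 12 * hw)
  have hU : ∀ t, (1 - 3 * (1 / 2 - w / 6) * t) ^ 3 = 3 * w * (t - (1 / 2 + w / 6)) ^ 3 :=
    fun t => by grind
  have hT : equianharmonicSextic.R₁ = 4 * (C (3 * w) * (X - C (1 / 2 + w / 6)) ^ 3 - C (1 / 2)) ^ 2 :=
    Polynomial.funext fun t => by
      simp only [R₁, hpinv, eval_mul, eval_sub, eval_pow, eval_one, eval_C, eval_X, hU]
  have hT1 : ∀ t, 3 * w * (t - (1 / 2 + w / 6)) ^ 3 - 1 =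
      3 * w * (t * (t - 1) * (t - (1 / 2 + w / 2))) := fun t => by grind
  have hT' : ∀ t, (derivative equianharmonicSextic.R₁).eval t =
      8 * (3 * w * (t - (1 / 2 + w / 6)) ^ 3 - 1 / 2) *
        (9 * w * (t - (1 / 2 + w / 6)) ^ 2) := fun t => by
    rw [hT]; simp [derivative_pow]; ring
  replace hT : ∀ t, equianharmonicSextic.R₁.eval t =
      4 * (3 * w * (t - (1 / 2 + w / 6)) ^ 3 - 1 / 2) ^ 2 := fun t => by
    rw [hT]; simp
  have hT1' : ∀ t, 4 * (3 * w * (t - (1 / 2 + w / 6)) ^ 3 - 1 / 2) ^ 2 - 1 =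
      4 * (3 * w * (t - (1 / 2 + w / 6)) ^ 3) *
        (3 * w * (t * (t - 1) * (t - (1 / 2 + w / 2)))) := fun t => by rw [← hT1]; ring
  rw [hp, hD]
  refine .of_logDeriv (κ := -1 / 36) (by norm_num)
    (derivative_ne_zero_of_eval (t := 1 / 2) (by rw [hT']; grind))
    (fun t => ?_) fun t h0 h1 hp hd0 hd1 hd2 => ?_
  · rw [← neg_sub _ (1 : ℂ), hT, hT1', hT']; simp; ring
  · rw [hT] at *
    rw [hT', hθ0, hθ1, hθ2]
    simp only [Matrix.cons_val, sub_zero] at *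
    have hd : (t - 1) * (t - (1 / 2 + w / 2)) + t * (t - (1 / 2 + w / 2)) + t * (t - 1) =
      3 * (t - (1 / 2 + w / 6)) ^ 2 := by grind
    -- With `U = 3w (t - p₀)³`, the cubic substitution, `R₁ - 1 = 4U (U - 1)` and `2U - 1 = U + (U -
    -- 1)`; so the quotient `e2` splits as `U'/U + U'/(U - 1)`.
    have hV : 2 * (3 * w * (t - (1 / 2 + w / 6)) ^ 3 - 1 / 2) =
        3 * w * (t - (1 / 2 + w / 6)) ^ 3 +
          3 * w * (t * (t - 1) * (t - (1 / 2 + w / 2))) := by rw [← hT1]; ring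
    have e2 : 8 * (3 * w * (t - (1 / 2 + w / 6)) ^ 3 - 1 / 2) *
        (9 * w * (t - (1 / 2 + w / 6)) ^ 2) / (4 * (3 * w * (t - (1 / 2 + w / 6)) ^ 3) *
        (3 * w * (t * (t - 1) * (t - (1 / 2 + w / 2))))) =
          3 / (t - (1 / 2 + w / 6)) +
            (1 / t + 1 / (t - 1) + 1 / (t - (1 / 2 + w / 2))) := by
      rw [show ∀ a b : ℂ, 8 * a * b = 4 * (2 * a) * b by intros; ring, hV]
      generalize t - (1 / 2 + w / 2) = y at *
      generalize t - (1 / 2 + w / 6) = z at *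
      field_simp
      linear_combination -3 * z * hd
    rw [hT1', e2]
    ring

theorem exists_isReductionIdentity (k : ReductionType)
    (h : k.ExponentCondition (θ 0) (θ 1) (θ 2)) :
    ∃ e₀ e₁, IsReductionIdentity ![0, 1, k.D] θ k.p₀ e₀ e₁ k.R₁ := by
  cases k
  · exact ⟨_, _, isReductionIdentity_harmonicQuadratic h⟩
  · exact ⟨_, _, isReductionIdentity_collinearCubic h.1 h.2⟩
  · exact ⟨_, _, isReductionIdentity_harmonicQuartic h.1 h.2⟩
  · exact ⟨_, _, isReductionIdentity_equianharmonicCubic h.1 h.2⟩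
  · exact ⟨_, _, isReductionIdentity_isoscelesQuartic h.1 h.2.1 h.2.2⟩
  · exact ⟨_, _, isReductionIdentity_isoscelesQuintic h.1 h.2.1 h.2.2⟩
  · exact ⟨_, _, isReductionIdentity_equianharmonicSextic h.1 h.2.1 h.2.2⟩

end ReductionType

theorem IsStandardReduction.exists_isReductionIdentity {d θ : Fin 3 → ℂ} {p : ℂ} {P : ℂ[X]}
    (h : IsStandardReduction d θ p P) : ∃ e₀ e₁, IsReductionIdentity d θ p e₀ e₁ P := by
  obtain ⟨k, A, hθ, hp, hP⟩ := h
  obtain ⟨e₀, e₁, hid⟩ := k.exists_isReductionIdentity (θ := θ ∘ A.σ) hθ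
  have hsub : IsReductionIdentity d θ p e₀ e₁ A.substitution := by
    refine .of_comp A.σ (.comp_affine A.m_ne_zero ?_)
    convert hid using 1
    · funext i
      fin_cases i
      · exact A.map_zero
      · exact A.map_one
      · exact A.map_D
    · rw [hp, ReductionType.Similarity.preimage, mul_div_cancel₀ _ A.m_ne_zero, sub_add_cancel]
  rcases hP with rfl | rfl
  · exact ⟨e₀, e₁, hsub⟩
  · exact ⟨e₁, e₀, hsub.swap⟩

/-! ### Affine symmetries of the model triangles and uniqueness of the accessory parameter. -/

namespace ReductionType

/-- The coincidences that an affine symmetry of the model triangle would force. -/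
theorem D_p₀_properties (k : ReductionType) :
    k.D ≠ 0 ∧ 2 * k.D ≠ 1 ∧ k.D ^ 2 ≠ 1 ∧ (k.D = 2 → k.p₀ = 1) ∧
      (k.D ^ 2 - k.D + 1 = 0 → k.p₀ = (1 + k.D) / 3) := by
  have h3 := Complex.I_mul_sqrt_sq (x := 3) (by norm_num)
  have h2 := Complex.I_mul_sqrt_sq (x := 2) (by norm_num)
  have h15 := Complex.I_mul_sqrt_sq (x := 15) (by norm_num)
  push_cast at h3 h2 h15
  -- Coincidences linear in `w = I√n`, possibly after using `w² = -n`, would make `w` a rational `b`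
  -- with `b² ≠ -n`.
  have hne : ∀ {w a b : ℂ}, w ^ 2 = a → b ^ 2 ≠ a → w ≠ b := fun h h' h'' => h' (h'' ▸ h)
  have hequi : ∀ D : ℂ, D = 1 / 2 + Complex.I * (Real.sqrt 3 : ℂ) / 2 →
      D ≠ 0 ∧ 2 * D ≠ 1 ∧ D ^ 2 ≠ 1 ∧ D ≠ 2 := by
    rintro _ rfl
    refine ⟨fun h => hne (b := -1) h3 (by norm_num) ?_, fun h => hne (b := 0) h3 (by norm_num) ?_,
      fun h => hne (b := 3) h3 (by norm_num) ?_, fun h => hne (b := 3) h3 (by norm_num) ?_⟩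
    · linear_combination 2 * h
    · linear_combination h
    · linear_combination 2 * h - 1 / 2 * h3
    · linear_combination 2 * h
  cases k
  · norm_num [D, p₀]
  · norm_num [D, p₀]
  · norm_num [D, p₀]
  · obtain ⟨a, b, c, e⟩ := hequi equianharmonicCubic.D rfl
    exact ⟨a, b, c, fun h => absurd h e, fun _ => by simp only [D, p₀]; ring⟩
  · simp only [D, p₀]
    refine ⟨fun h => hne (b := -2 / 5) h2 (by norm_num) ?_,
      fun h => hne (b := 0) h2 (by norm_num) ?_, fun h => hne (b := 31 / 10) h2 (by norm_num) ?_,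
      fun h => absurd ?_ (hne (b := 6 / 5) h2 (by norm_num)), fun h => ?_⟩
    · linear_combination 4 / 5 * h
    · linear_combination 2 / 5 * h
    · linear_combination 4 / 5 * h - 5 / 4 * h2
    · linear_combination 4 / 5 * h
    · have : (19 : ℂ) = 0 := by linear_combination -8 * h + 25 / 2 * h2
      norm_num at this
  · simp only [D, p₀]
    refine ⟨fun h => hne (b := -45 / 11) h15 (by norm_num) ?_,
      fun h => hne (b := 0) h15 (by norm_num) ?_, fun h => hne (b := 263 / 33) h15 (by norm_num) ?_,
      fun h => absurd ?_ (hne (b := 135 / 11) h15 (by norm_num)), fun h => ?_⟩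
    · linear_combination 90 / 11 * h
    · linear_combination 45 / 11 * h
    · linear_combination 90 / 11 * h - 11 / 90 * h15
    · linear_combination 90 / 11 * h
    · have : (284 / 540 : ℂ) = 0 := by linear_combination h - 121 / 8100 * h15
      norm_num at this
  · obtain ⟨a, b, c, e⟩ := hequi equianharmonicSextic.D rfl
    exact ⟨a, b, c, fun h => absurd h e, fun _ => by simp only [D, p₀]; ring⟩

namespace Similarity

theorem perm_fin_three_cases : ∀ σ σ' : Equiv.Perm (Fin 3),
    (σ' 0 = σ 0 ∧ σ' 1 = σ 1 ∧ σ' 2 = σ 2) ∨ (σ' 0 = σ 1 ∧ σ' 1 = σ 0 ∧ σ' 2 = σ 2) ∨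
    (σ' 0 = σ 2 ∧ σ' 1 = σ 1 ∧ σ' 2 = σ 0) ∨ (σ' 0 = σ 0 ∧ σ' 1 = σ 2 ∧ σ' 2 = σ 1) ∨
    (σ' 0 = σ 1 ∧ σ' 1 = σ 2 ∧ σ' 2 = σ 0) ∨ (σ' 0 = σ 2 ∧ σ' 1 = σ 0 ∧ σ' 2 = σ 1) := by
  decide

/-- The point `p₀` is fixed by the affine symmetries of the model triangle. -/
theorem preimage_p₀_eq {k : ReductionType} {d : Fin 3 → ℂ} (A B : k.Similarity d) :
    A.preimage k.p₀ = B.preimage k.p₀ := by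
  obtain ⟨hD0, hD1, hD2, hD3, hD4⟩ := k.D_p₀_properties
  have hA := A.m_ne_zero
  -- `B` is `A` followed by `t ↦ μ t + ν`, which therefore permutes `0, 1, D`; it remains to see
  -- that it fixes `p₀`.
  obtain ⟨μ, hμ⟩ : ∃ μ, B.m = μ * A.m := ⟨B.m / A.m, by field_simp⟩
  obtain ⟨ν, hν⟩ : ∃ ν, B.n = μ * A.n + ν := ⟨B.n - μ * A.n, by ring⟩
  have hfix : k.p₀ = μ * k.p₀ + ν → A.preimage k.p₀ = B.preimage k.p₀ := fun h => by
    have hB := B.m_ne_zero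
    rw [preimage, preimage, div_eq_div_iff hA hB, hμ, hν]
    linear_combination -A.m * h
  have hB : ∀ s, B.m * s + B.n = μ * (A.m * s + A.n) + ν := fun s => by rw [hμ, hν]; ring
  have h0 := B.map_zero
  have h1 := B.map_one
  have h2 := B.map_D
  rw [hB] at h0 h1 h2
  refine hfix ?_
  -- Exchanging `0, 1` needs `2D = 1`, exchanging `1, D` needs `D² = 1`: both excluded. Exchanging
  -- `0, D` needs `D = 2` and fixes `1 = p₀`. The 3-cycles need `D² - D + 1 = 0` and fix the
  -- centroid, again `p₀`.
  rcases perm_fin_three_cases A.σ B.σ with h | h | h | h | h | h <;>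
    rw [h.1] at h0 <;> rw [h.2.1] at h1 <;> rw [h.2.2] at h2 <;>
    simp only [A.map_zero, A.map_one, A.map_D] at h0 h1 h2
  · have hμ1 : μ = 1 := by linear_combination h1 - h0
    rw [hμ1] at h0 ⊢
    linear_combination -h0
  · exact absurd (by linear_combination (1 - k.D) * h1 + k.D * h0 - h2) hD1
  · have hD : k.D = 2 := mul_left_cancel₀ hD0 (by
      linear_combination k.D * h1 + (1 - k.D) * h2 - h0)
    rw [hD3 hD]
    linear_combination -h1
  · exact absurd (by linear_combination (k.D - 1) * h0 - k.D * h2 + h1) hD2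
  · have hD : k.D ^ 2 - k.D + 1 = 0 := by linear_combination k.D * h0 + (1 - k.D) * h2 - h1
    rw [hD4 hD]
    linear_combination (1 / 3 : ℂ) * hD - (1 + k.D) / 3 * h0 - (2 - k.D) / 3 * h2
  · have hD : k.D ^ 2 - k.D + 1 = 0 := by linear_combination h0 - k.D * h2 + (k.D - 1) * h1
    rw [hD4 hD]
    linear_combination (-1 / 3 : ℂ) * hD - (1 + k.D) / 3 * h2 - (2 - k.D) / 3 * h1

end Similarity

end ReductionType

/-! ### The classification. -/

theorem mainTheorem5 (d₁ d₂ d₃ α β γ δ ε q' : ℂ)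
    (h₁₂ : d₁ ≠ d₂) (h₁₃ : d₁ ≠ d₃) (h₂₃ : d₂ ≠ d₃)
    (hFuchs : α + β - γ - δ - ε + 1 = 0)
    (hsing₁ : (generalHeunODE d₁ d₂ d₃ α β γ δ ε q').IsSingularAt d₁)
    (hsing₂ : (generalHeunODE d₁ d₂ d₃ α β γ δ ε q').IsSingularAt d₂)
    (hsing₃ : (generalHeunODE d₁ d₂ d₃ α β γ δ ε q').IsSingularAt d₃)
    (hsing_inf : (generalHeunODE d₁ d₂ d₃ α β γ δ ε q').IsSingularAtInfinity)
    (hnontrivial : α * β ≠ 0 ∨ q' ≠ 0) :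
    -- existence of a reduction
    ((∃ (R : RatFunc ℂ) (a b c : ℂ),
        ReducesToHypergeometric (generalHeunODE d₁ d₂ d₃ α β γ δ ε q') R a b c) ↔
      α * β ≠ 0 ∧ ∃ (k : ReductionType) (A : k.Similarity ![d₁, d₂, d₃]),
        A.ExponentCondition ![γ, δ, ε] ∧ q' = α * β * A.preimage k.p₀) ∧
    -- the rational substitutions that reduce the equation
    (∀ R : RatFunc ℂ,
      (∃ a b c : ℂ,
        ReducesToHypergeometric (generalHeunODE d₁ d₂ d₃ α β γ δ ε q') R a b c) ↔
      α * β ≠ 0 ∧ ∃ P : ℂ[X], R = algebraMap ℂ[X] (RatFunc ℂ) P ∧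
        ∃ (k : ReductionType) (A : k.Similarity ![d₁, d₂, d₃]),
          A.ExponentCondition ![γ, δ, ε] ∧ q' = α * β * A.preimage k.p₀ ∧
            (P = A.substitution ∨ P = 1 - A.substitution)) ∧
    -- the required accessory parameter is determined by the choice of subcase
    (∀ k : ReductionType,
      (∃ A : k.Similarity ![d₁, d₂, d₃], A.ExponentCondition ![γ, δ, ε]) →
        ∃! x : ℂ, ∃ A : k.Similarity ![d₁, d₂, d₃],
          A.ExponentCondition ![γ, δ, ε] ∧ x = α * β * A.preimage k.p₀) := by
  -- The description of all reducing substitutions also yields the existence criterion, with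
  -- `A.substitution` as witness.
  have key : ∀ R : RatFunc ℂ,
      (∃ a b c : ℂ,
        ReducesToHypergeometric (generalHeunODE d₁ d₂ d₃ α β γ δ ε q') R a b c) ↔
      α * β ≠ 0 ∧ ∃ P : ℂ[X], R = algebraMap ℂ[X] (RatFunc ℂ) P ∧
        ∃ (k : ReductionType) (A : k.Similarity ![d₁, d₂, d₃]),
          A.ExponentCondition ![γ, δ, ε] ∧ q' = α * β * A.preimage k.p₀ ∧
            (P = A.substitution ∨ P = 1 - A.substitution) := by
    intro R
    constructor
    · rintro ⟨a, b, c, h⟩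
      obtain ⟨hαβ, P, hR, hP⟩ :=
        h.isPolynomialReduction h₁₂ h₁₃ h₂₃ hsing₁ hsing₂ hsing₃ hnontrivial
      obtain ⟨k, A, hA, hp, hsub⟩ := hP.isStandardReduction
      exact ⟨hαβ, P, hR, k, A, hA, by rw [← hp, mul_div_cancel₀ _ hαβ], hsub⟩
    · rintro ⟨-, P, rfl, k, A, hA, rfl, hsub⟩
      obtain ⟨e₀, e₁, hid⟩ :=
        IsStandardReduction.exists_isReductionIdentity ⟨k, A, hA, rfl, hsub⟩
      exact hid.reducesToHypergeometric
  refine ⟨⟨fun ⟨R, h⟩ => ?_, fun ⟨hαβ, k, A, hA, hq⟩ => ?_⟩, key, fun k ⟨A, hA⟩ => ?_⟩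
  · obtain ⟨hαβ, P, -, k, A, hA, hq, -⟩ := (key R).mp h
    exact ⟨hαβ, k, A, hA, hq⟩
  · exact ⟨_, (key _).mpr ⟨hαβ, _, rfl, k, A, hA, hq, Or.inl rfl⟩⟩
  · refine ⟨_, ⟨A, hA, rfl⟩, ?_⟩
    rintro _ ⟨B, -, rfl⟩
    rw [B.preimage_p₀_eq A]
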